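/- Let $\mathbb F$ be a field of characteristic $0$ and $\mathbb N=\{0,1,2,\dots\}$. A conformal algebra is an $\mathbb F[\partial]$-module $R$ with bilinear products $u_nv$ ($n\in\mathbb N$), written $Y^+(u,z)v=\sum_{n\ge 0}(u_nv)z^{-n-1}\in R[z^{-1}]z^{-1}$, such that for all $u,v\in R$ $$Y^+(\partial u,z)=\tfrac{d}{dz}Y^+(u,z),\qquad Y^+(u,z)v=\mathrm{Res}_x\frac{e^{x\partial}Y^+(v,-x)u}{z-x},$$ $$Y^+(u,z_1)Y^+(v,z_2)-Y^+(v,z_2)Y^+(u,z_1)=\mathrm{Res}_x\frac{Y^+(Y^+(u,z_1-x)v,x)}{z_2-x}.$$ A subalgebra is a subspace closed under $\partial$ and all products $u_nv$. An ideal of $R$ is a subspace $I$ with $\partial I\subset I$ and $u_nI\subset I$ for all $u\in R$, $n\in\mathbb N$; $R$ is simple if its only ideals are $0$ and $R$. $R$ is generated by $S\subset R$ if $R$ is the linear span of the elements $u^1_{m_1}\cdots u^p_{m_p}v$ with $u^1,\dots,u^p,v\in S$ and $p,m_1,\dots,m_p\in\mathbb N$. Let $k\ge 1$ and let $R(M_k(\mathbb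 F))$ be the direct sum over $i\in\{0,1\}$ and $m,n\in\mathbb N$ of copies $\{u_{[i,i]}(m,n)\mid u\in M_k(\mathbb F)\}$ of $M_k(\mathbb F)$, with $$\partial u_{[i,i]}(m,n)=(m+1)u_{[i,i]}(m+1,n)+(n+1)u_{[i,i]}(m,n+1)$$ and, with $d=\delta_{i,0}$, $$\begin{aligned}Y^+(u_{[i,i]}(m_1,m_2),z)\,v_{[j,j]}(n_1,n_2)&=\delta_{i,j}(n_1d+1)\tbinom{-n_1-1-d}{m_2}\sum_{p=0}^{m_1+m_2+n_1+d}\tbinom{p}{m_1}(uv)_{[i,i]}(p,n_2)\,z^{p-m_1-m_2-n_1-1-d}\\&\quad-\delta_{i,j}\bigl(\delta_{i,1}-(n_2+1)\delta_{i,0}\bigr)\tbinom{-n_2-1-d}{m_1}\sum_{q=0}^{m_1+m_2+n_2+d}\tbinom{q}{m_2}(vu)_{[i,i]}(n_1,q)\,z^{q-m_1-m_2-n_2-1-d}.\end{aligned}$$ Put $$R_{k\times k,1}=\mathrm{span}\{u_{[1,1]}(m,n)\mid u\in M_k(\mathbb F),\ m,n\in\mathbb N\},\qquad R_{k\times k,\ell+2}=\mathrm{span}\{u_{[0,0]}(m,n)\mid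 u\in M_k(\mathbb F),\ m,n\in\mathbb N,\ n\ge \ell\}\quad(\ell\in\mathbb N).$$ The element $u_{[i,i]}(m,n)$ has weight $m+n+1+\delta_{i,0}$, and $R_{k\times k,\ell}^{(w)}$ denotes the span of the elements $u_{[i,i]}(m,n)$ of weight $w$ in $R_{k\times k,\ell}$; the minimal weight of $R_{k\times k,\ell}$ is $\ell$. Write $u(m,n)=u_{[0,0]}(m,n)$ and let $I_1$ be the $1\times 1$ identity matrix. **Theorem.** $R(M_k(\mathbb F))$ is a conformal algebra, and for every $\ell\ge 1$ the subspace $R_{k\times k,\ell}$ is a subalgebra of it which is simple. Moreover: 1. if $k>1$ and $\ell\ge 2$, then $R_{k\times k,\ell}$ is generated by $R_{k\times k,\ell}^{(\ell)}$; 2. if $k=1$ and $\ell\in\mathbb N$, then $R_{1\times 1,\ell+2}$ is generated by $\{I_1(0,\ell),\,I_1(0,\ell+1)\}$; 3. if $k>1$, then $R_{k\times k,1}$ is generated by $R_{k\times k,1}^{(2)}$; 4. if $k=1$, then $R_{1\times 1,1}$ is generated by $\{(I_1)_{[1,1]}(1,0),\,(I_1)_{[1,1]}(0,2)\}$. -/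

import Mathlib

/-- `(R, D, P)` is a conformal algebra over the field `F`: `D` is the operator `∂` and
`P n u v` is the `n`-th product `u_n v`, that is, `Y⁺(u, z) v = ∑_{n ≥ 0} (u_n v) z^{-n-1}`.
The fields are the coefficients of the usual generating-function axioms. -/
structure IsConformalAlgebra (F : Type*) [Field F] {R : Type*} [AddCommGroup R] [Module F R]
    (D : R →ₗ[F] R) (P : ℕ → R →ₗ[F] R →ₗ[F] R) : Prop where
  /-- `Y⁺(u, z) v` is a polynomial in `z⁻¹`. -/
  finite : ∀ u v : R, ∃ N : ℕ, ∀ n : ℕ, N ≤ n → P n u v = 0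
  /-- `Y⁺(∂ u, z) = d/dz Y⁺(u, z)`, coefficient of `z⁻¹`. -/
  deriv_zero : ∀ u v : R, P 0 (D u) v = 0
  /-- `Y⁺(∂ u, z) = d/dz Y⁺(u, z)`, coefficient of `z^{-n-2}`. -/
  deriv_succ : ∀ (n : ℕ) (u v : R), P (n + 1) (D u) v = -((n : F) + 1) • P n u v
  /-- Skew-symmetry `Y⁺(u, z) v = Res_x (z - x)⁻¹ e^{x∂} Y⁺(v, -x) u`, coefficient of `z^{-n-1}`;
  the sum over `j` may be cut off at any `N` from which on the products `v_m u` vanish. -/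
  skew : ∀ (n N : ℕ) (u v : R), (∀ m : ℕ, N ≤ m → P m v u = 0) →
    P n u v = ∑ j ∈ Finset.range N,
      ((-1 : F) ^ (n + j + 1) * ((Nat.factorial j : ℕ) : F)⁻¹) • (D ^ j) (P (n + j) v u)
  /-- The commutator formula, coefficient of `z₁^{-m-1} z₂^{-n-1}`. -/
  jacobi : ∀ (m n : ℕ) (u v w : R), P m u (P n v w) - P n v (P m u w) =
    ∑ i ∈ Finset.range (m + 1), ((Nat.choose m i : ℕ) : F) • P (m + n - i) (P i u v) w

/-- The subspace `S` is a conformal subalgebra. -/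
def IsConformalSubalgebra {F : Type*} [Field F] {R : Type*} [AddCommGroup R] [Module F R]
    (D : R →ₗ[F] R) (P : ℕ → R →ₗ[F] R →ₗ[F] R) (S : Submodule F R) : Prop :=
  (∀ u ∈ S, D u ∈ S) ∧ ∀ n : ℕ, ∀ u ∈ S, ∀ v ∈ S, P n u v ∈ S

/-- `I` is an ideal of the conformal algebra `S`. -/
def IsConformalIdeal {F : Type*} [Field F] {R : Type*} [AddCommGroup R] [Module F R]
    (D : R →ₗ[F] R) (P : ℕ → R →ₗ[F] R →ₗ[F] R) (S I : Submodule F R) : Prop :=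
  I ≤ S ∧ (∀ v ∈ I, D v ∈ I) ∧ ∀ n : ℕ, ∀ u ∈ S, ∀ v ∈ I, P n u v ∈ I

/-- The conformal algebra `S` is simple: its only ideals are `0` and `S`. -/
def IsSimpleConformal {F : Type*} [Field F] {R : Type*} [AddCommGroup R] [Module F R]
    (D : R →ₗ[F] R) (P : ℕ → R →ₗ[F] R →ₗ[F] R) (S : Submodule F R) : Prop :=
  ∀ I : Submodule F R, IsConformalIdeal D P S I → I = ⊥ ∨ I = S

/-- The elements `u¹_{m₁} ⋯ uᵖ_{mₚ} v` with `u¹, …, uᵖ, v ∈ T` and `p, m₁, …, mₚ ∈ ℕ`. -/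
inductive ConformalWord {F : Type*} [Field F] {R : Type*} [AddCommGroup R] [Module F R]
    (P : ℕ → R →ₗ[F] R →ₗ[F] R) (T : Set R) : R → Prop
  | base (v : R) : v ∈ T → ConformalWord P T v
  | step (m : ℕ) (u w : R) : u ∈ T → ConformalWord P T w → ConformalWord P T (P m u w)

/-- The conformal algebra `S` is generated by the set `T`:
`S = span {u¹_{m₁} ⋯ uᵖ_{mₚ} v | uʲ, v ∈ T; p, mⱼ ∈ ℕ}`. -/
def IsConformallyGeneratedBy {F : Type*} [Field F] {R : Type*} [AddCommGroup R] [Module F R]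
    (P : ℕ → R →ₗ[F] R →ₗ[F] R) (S : Submodule F R) (T : Set R) : Prop :=
  S = Submodule.span F {w : R | ConformalWord P T w}

/-- The space `R(A)` attached to an associative algebra `A` (regarded as a `ℤ/2`-graded algebra with
zero odd part): the direct sum, over `i ∈ {0, 1}` and `m, n ∈ ℕ`, of the copies
`{u_{[i,i]}(m, n) | u ∈ A}` of `A`, i.e. the diagonal `2 × 2` matrices over `A`
tensored with the polynomials in two variables. -/
abbrev DoubleAff (A : Type*) [Zero A] : Type _ := (Fin 2 × ℕ × ℕ) →₀ A

/-- The element `u_{[i,i]}(m, n)`. -/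
noncomputable def dblElt {A : Type*} [Zero A] (i : Fin 2) (u : A) (m n : ℕ) : DoubleAff A :=
  Finsupp.single (i, m, n) u

/-- The Kronecker delta `δ_{i,0}`. -/
def kd0 (i : Fin 2) : ℕ := if i = 0 then 1 else 0

/-- `∂ u_{[i,i]}(m, n) = (m+1) u_{[i,i]}(m+1, n) + (n+1) u_{[i,i]}(m, n+1)`. -/
noncomputable def dblD (F : Type*) [Field F] (A : Type*) [Ring A] [Algebra F A] :
    DoubleAff A →ₗ[F] DoubleAff A :=
  Finsupp.lsum F fun a : Fin 2 × ℕ × ℕ =>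
    ((a.2.1 : F) + 1) • Finsupp.lsingle (a.1, a.2.1 + 1, a.2.2) +
      ((a.2.2 : F) + 1) • Finsupp.lsingle (a.1, a.2.1, a.2.2 + 1)

/-- The coefficient of `z^{-N-1}` in
`Y⁺(u_{[i,i]}(m₁, m₂), z) v_{[j,j]}(n₁, n₂)`, which is zero for `i ≠ j` and for `i = j` equals,
with `d = δ_{i,0}`,
`(n₁ d + 1) binom(-n₁-1-d, m₂) ∑_{p=0}^{m₁+m₂+n₁+d} binom(p, m₁) (uv)_{[i,i]}(p, n₂)
z^{p-m₁-m₂-n₁-1-d} - (δ_{i,1} - (n₂+1) δ_{i,0}) binom(-n₂-1-d, m₁)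
∑_{q=0}^{m₁+m₂+n₂+d} binom(q, m₂) (vu)_{[i,i]}(n₁, q) z^{q-m₁-m₂-n₂-1-d}`. -/
noncomputable def dblCoeff {A : Type*} [Ring A] (N : ℕ) (i : Fin 2) (u : A) (m₁ m₂ : ℕ)
    (j : Fin 2) (v : A) (n₁ n₂ : ℕ) : DoubleAff A :=
  if i = j then
    (∑ p ∈ Finset.range (m₁ + m₂ + n₁ + kd0 i + 1),
      if p + N = m₁ + m₂ + n₁ + kd0 i then
        (((n₁ : ℤ) * kd0 i + 1) * Ring.choose (-(n₁ : ℤ) - 1 - kd0 i) m₂ * (Nat.choose p m₁ : ℤ)) •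
          dblElt i (u * v) p n₂
      else 0) -
    (∑ q ∈ Finset.range (m₁ + m₂ + n₂ + kd0 i + 1),
      if q + N = m₁ + m₂ + n₂ + kd0 i then
        (((1 - kd0 i : ℤ) - ((n₂ : ℤ) + 1) * kd0 i) *
          Ring.choose (-(n₂ : ℤ) - 1 - kd0 i) m₁ * (Nat.choose q m₂ : ℤ)) •
          dblElt i (v * u) n₁ q
      else 0)
  else 0

/-- `dblCoeff` as a bilinear map in `u` and `v`. -/
noncomputable def dblCoeffBilin (F : Type*) [Field F] (A : Type*) [Ring A] [Algebra F A] (N : ℕ)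
    (a b : Fin 2 × ℕ × ℕ) : A →ₗ[F] A →ₗ[F] DoubleAff A :=
  LinearMap.mk₂ F (fun u v => dblCoeff N a.1 u a.2.1 a.2.2 b.1 v b.2.1 b.2.2)
    (by
      intro u u' v
      unfold dblCoeff dblElt
      split_ifs
      · rw [sub_add_sub_comm, ← Finset.sum_add_distrib, ← Finset.sum_add_distrib]
        congr 1 <;> refine Finset.sum_congr rfl fun x _ => ?_ <;> split_ifs <;>
          simp [add_mul, mul_add, Finsupp.single_add, smul_add]
      · simp)
    (by
      intro c u v
      unfold dblCoeff dblElt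
      split_ifs
      · rw [smul_sub, Finset.smul_sum, Finset.smul_sum]
        congr 1 <;> refine Finset.sum_congr rfl fun x _ => ?_ <;> split_ifs <;>
          simp only [smul_mul_assoc, mul_smul_comm, ← Finsupp.smul_single, smul_zero] <;>
          exact smul_comm _ _ _
      · simp)
    (by
      intro u v v'
      unfold dblCoeff dblElt
      split_ifs
      · rw [sub_add_sub_comm, ← Finset.sum_add_distrib, ← Finset.sum_add_distrib]
        congr 1 <;> refine Finset.sum_congr rfl fun x _ => ?_ <;> split_ifs <;>
          simp [add_mul, mul_add, Finsupp.single_add, smul_add]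
      · simp)
    (by
      intro c u v
      unfold dblCoeff dblElt
      split_ifs
      · rw [smul_sub, Finset.smul_sum, Finset.smul_sum]
        congr 1 <;> refine Finset.sum_congr rfl fun x _ => ?_ <;> split_ifs <;>
          simp only [smul_mul_assoc, mul_smul_comm, ← Finsupp.smul_single, smul_zero] <;>
          exact smul_comm _ _ _
      · simp)

/-- The `N`-th product of `R(A)`: the bilinear extension of `dblCoeff N`. -/
noncomputable def dblP (F : Type*) [Field F] (A : Type*) [Ring A] [Algebra F A] (N : ℕ) :
    DoubleAff A →ₗ[F] DoubleAff A →ₗ[F] DoubleAff A :=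
  Finsupp.lsum F fun a : Fin 2 × ℕ × ℕ =>
    LinearMap.flip (Finsupp.lsum F fun b : Fin 2 × ℕ × ℕ =>
      LinearMap.flip (dblCoeffBilin F A N a b))

theorem dblP_dblElt (F : Type*) [Field F] (A : Type*) [Ring A] [Algebra F A] (N : ℕ)
    (i : Fin 2) (u : A) (m₁ m₂ : ℕ) (j : Fin 2) (v : A) (n₁ n₂ : ℕ) :
    dblP F A N (dblElt i u m₁ m₂) (dblElt j v n₁ n₂) = dblCoeff N i u m₁ m₂ j v n₁ n₂ := by
  simp [dblP, dblElt, dblCoeffBilin]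

theorem dblD_dblElt (F : Type*) [Field F] (A : Type*) [Ring A] [Algebra F A]
    (i : Fin 2) (u : A) (m n : ℕ) :
    dblD F A (dblElt i u m n) =
      ((m : F) + 1) • dblElt i u (m + 1) n + ((n : F) + 1) • dblElt i u m (n + 1) := by
  simp [dblD, dblElt]

/-- The algebra `R(M_{k × k}(F))`, as a space. -/
abbrev RMat (F : Type*) [Field F] (k : ℕ) : Type _ := DoubleAff (Matrix (Fin k) (Fin k) F)

/-- The subspace `R_{k×k,ℓ}` of `R(M_{k × k}(F))`, for `ℓ ≥ 1` (the value at `ℓ = 0` is not used). -/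
noncomputable def matConf (F : Type*) [Field F] (k : ℕ) : ℕ → Submodule F (RMat F k)
  | 0 => ⊥
  | 1 => Submodule.span F {x | ∃ (u : Matrix (Fin k) (Fin k) F) (m n : ℕ), x = dblElt 1 u m n}
  | ℓ + 2 => Submodule.span F
      {x | ∃ (u : Matrix (Fin k) (Fin k) F) (m n : ℕ), ℓ ≤ n ∧ x = dblElt 0 u m n}

/-- The subspace `R_{k×k,ℓ}^{(w)}` of `R_{k×k,ℓ}` of weight `w`, for `ℓ ≥ 1`. -/
noncomputable def matConfWeight (F : Type*) [Field F] (k : ℕ) : ℕ → ℕ → Submodule F (RMat F k)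
  | 0, _ => ⊥
  | 1, w => Submodule.span F
      {x | ∃ (u : Matrix (Fin k) (Fin k) F) (m n : ℕ), m + n + 1 = w ∧ x = dblElt 1 u m n}
  | ℓ + 2, w => Submodule.span F
      {x | ∃ (u : Matrix (Fin k) (Fin k) F) (m n : ℕ),
        ℓ ≤ n ∧ m + n + 2 = w ∧ x = dblElt 0 u m n}

/-! Axioms. The element `u_{[i,i]}(m, n)` is read as the `A`-valued polynomial `(-y)^d x^m y^n / (m!
n!) u`. Then `∂` is multiplication by `x + y`, and the series `∑ z^n/n! (f_n g)` becomes `f(x, -z-x)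
g(x+z, y) - g(x, y+z) f(-z-y, y)` (`exists_sum_divPow_smul_dblEval_dblP`), a commutator of kernels.
All binomials are absorbed by the divided powers. Since `F` is infinite, an element is determined by
its values, so each axiom is an identity between values: the commutator formula is associativity in
`A`, skew-symmetry is the substitution of `-z-x-y` for `z`, and the rule for `∂ f` holds because
both points at which `f` is evaluated have coordinate sum `-z`.

Simplicity. Multiplying by an element one of whose indices is very large kills one half of the
product and picks out the part of extreme degree in the other half. Three such products carry a
nonzero element of an ideal to all `(u z v)(m, n)` with one fixed `z ≠ 0`, and these span because a
matrix algebra is simple.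

Generation. Products by generators that raise the degree by one give combinations of `(uv)(m+1, n)`
and `(vu)(m, n+1)`. For `k = 1` two such relations are independent, so both elements are reached.
For `k > 1` matrix units separate the off-diagonal entries and the differences of diagonal ones; a
product preserving the degree then supplies the diagonal at `m = 0`, from which it spreads to all
`m`. -/

/-- A polynomial in `z ∈ F`, with coefficients in a vector space, that vanishes at all `z ≠ 0` has
zero coefficients. -/
theorem coeff_eq_zero_of_forall_sum_pow_smul {F : Type*} [Field F] [CharZero F] {A : Type*}
    [AddCommGroup A] [Module F A] (N : ℕ) (a : ℕ → A)
    (h : ∀ z : F, z ≠ 0 → ∑ n ∈ Finset.range N, z ^ n • a n = 0) (n : ℕ) (hn : n < N) :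
    a n = 0 := by
  rw [← Module.forall_dual_apply_eq_zero_iff F]
  intro φ
  set p : Polynomial F := ∑ n ∈ Finset.range N, Polynomial.monomial n (φ (a n)) with hp
  have hp0 : p = 0 := by
    apply Polynomial.eq_zero_of_infinite_isRoot
    refine Set.Infinite.mono (s := {0}ᶜ) ?_ (Set.finite_singleton (0 : F)).infinite_compl
    intro z hz
    have := congrArg φ (h z hz)
    simp only [map_sum, map_smul, smul_eq_mul, map_zero] at this
    simp only [Set.mem_ofPred_eq, Polynomial.IsRoot.def, hp, Polynomial.eval_finsetSum,
      Polynomial.eval_monomial]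
    rw [← this]
    exact Finset.sum_congr rfl fun _ _ => mul_comm _ _
  have := congrArg (fun q => Polynomial.coeff q n) hp0
  simpa [hp, Polynomial.finsetSum_coeff, Polynomial.coeff_monomial, hn] using this

/-! ### Divided powers -/

/-- The divided power `z^n / n!`. -/
noncomputable def divPow {F : Type*} [Field F] (z : F) (n : ℕ) : F := z ^ n / (n.factorial : F)

theorem divPow_add {F : Type*} [Field F] [CharZero F] (x y : F) (n : ℕ) :
    divPow (x + y) n = ∑ p ∈ Finset.HasAntidiagonal.antidiagonal n, divPow x p.1 * divPow y p.2 := by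
  have hn : ((n.factorial : ℕ) : F) ≠ 0 := by exact_mod_cast n.factorial_ne_zero
  rw [divPow, (Commute.all x y).add_pow', div_eq_iff hn, Finset.sum_mul]
  refine Finset.sum_congr rfl fun p hp => ?_
  rw [Finset.HasAntidiagonal.mem_antidiagonal] at hp
  subst hp
  have h1 : ((p.1.factorial : ℕ) : F) ≠ 0 := by exact_mod_cast p.1.factorial_ne_zero
  have h2 : ((p.2.factorial : ℕ) : F) ≠ 0 := by exact_mod_cast p.2.factorial_ne_zero
  have h3 := Nat.add_choose_mul_factorial_mul_factorial p.1 p.2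
  have h4 : ((((p.1 + p.2).choose p.1 : ℕ) : F)) * (p.1.factorial : F) * (p.2.factorial : F)
    = ((p.1 + p.2).factorial : F) := by
    rw [← h3, Nat.choose_symm_add]; push_cast; ring
  rw [← h4, divPow, divPow, nsmul_eq_mul]
  field_simp

theorem coeff_eq_of_forall_sum_divPow_smul {F : Type*} [Field F] [CharZero F] {A : Type*}
    [AddCommGroup A] [Module F A] (N : ℕ) (a b : ℕ → A)
    (h : ∀ z : F, ∑ n ∈ Finset.range N, divPow z n • a n =
      ∑ n ∈ Finset.range N, divPow z n • b n) (n : ℕ) (hn : n < N) :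
    a n = b n := by
  have hf : ((n.factorial : ℕ) : F) ≠ 0 := by exact_mod_cast n.factorial_ne_zero
  have := coeff_eq_zero_of_forall_sum_pow_smul (F := F) N
    (fun n => ((n.factorial : ℕ) : F)⁻¹ • (a n - b n)) (fun z _ => by
      have h' := sub_eq_zero.2 (h z)
      rw [← Finset.sum_sub_distrib] at h'
      rw [← h']
      refine Finset.sum_congr rfl fun m _ => ?_
      rw [smul_smul, ← smul_sub, divPow, div_eq_mul_inv]) n hn
  rw [smul_eq_zero_iff_right (inv_ne_zero hf)] at this
  exact sub_eq_zero.1 this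

/-! ### Elements as polynomial functions in two variables -/

section Eval
variable {F : Type*} [Field F] {A : Type*} [Ring A] [Algebra F A]

/-- Evaluation at `(x, y)` of the polynomial attached to the `i`-th component: `u_{[i,i]}(m, n)` is
sent to `(-y)^d x^m y^n / (m! n!) u`, where `d = δ_{i,0}`. -/
noncomputable def dblEval (F : Type*) [Field F] (A : Type*) [Ring A] [Algebra F A] (i : Fin 2)
    (x y : F) : DoubleAff A →ₗ[F] A :=
  Finsupp.lsum F fun a : Fin 2 × ℕ × ℕ =>
    (if a.1 = i then (-y) ^ kd0 i * (divPow x a.2.1 * divPow y a.2.2) else 0) • LinearMap.id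

theorem dblEval_dblElt (i j : Fin 2) (x y : F) (u : A) (m n : ℕ) :
    dblEval F A i x y (dblElt j u m n) =
      (if j = i then (-y) ^ kd0 i * (divPow x m * divPow y n) else 0) • u := by
  rw [dblEval, dblElt, Finsupp.lsum_single]
  simp only [LinearMap.smul_apply, LinearMap.id_apply]

theorem dblEval_dblElt_self (i : Fin 2) (x y : F) (u : A) (m n : ℕ) :
    dblEval F A i x y (dblElt i u m n) = ((-y) ^ kd0 i * (divPow x m * divPow y n)) • u := by
  simp [dblEval_dblElt]

theorem dblElt_induction {A : Type*} [Ring A] {p : DoubleAff A → Prop} (f : DoubleAff A)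
    (h0 : p 0) (hadd : ∀ f g, p f → p g → p (f + g)) (helt : ∀ i u m n, p (dblElt i u m n)) :
    p f :=
  Finsupp.induction_linear f h0 hadd fun a b => helt a.1 b a.2.1 a.2.2

theorem divPow_succ [CharZero F] (x : F) (n : ℕ) :
    ((n : F) + 1) * divPow x (n + 1) = x * divPow x n := by
  have h1 : ((n.factorial : ℕ) : F) ≠ 0 := by exact_mod_cast n.factorial_ne_zero
  have h2 : (n : F) + 1 ≠ 0 := by exact_mod_cast n.succ_ne_zero
  rw [divPow, divPow, Nat.factorial_succ]
  push_cast
  field_simp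
  ring

/-- The divided-power normalisation absorbs the factors `m + 1` and `n + 1`, and the common factor
`(-y)^d` plays no part. -/
theorem dblEval_dblD [CharZero F] (i : Fin 2) (x y : F) (f : DoubleAff A) :
    dblEval F A i x y (dblD F A f) = (x + y) • dblEval F A i x y f := by
  induction f using dblElt_induction with
  | h0 => simp
  | hadd f g hf hg => simp [hf, hg]
  | helt j u m n =>
    rw [dblD_dblElt, map_add, map_smul, map_smul, dblEval_dblElt, dblEval_dblElt, dblEval_dblElt]
    split_ifs
    · rw [smul_smul, smul_smul, smul_smul, ← add_smul]
      congr 1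
      linear_combination ((-y) ^ kd0 i * divPow y n) * divPow_succ x m +
        ((-y) ^ kd0 i * divPow x m) * divPow_succ y n
    · simp

theorem dblEval_dblD_pow [CharZero F] (i : Fin 2) (x y : F) (n : ℕ) (f : DoubleAff A) :
    dblEval F A i x y ((dblD F A ^ n) f) = (x + y) ^ n • dblEval F A i x y f := by
  induction n with
  | zero => simp
  | succ n ih => rw [pow_succ', Module.End.mul_apply, dblEval_dblD, ih, smul_smul, pow_succ']

/-- Coefficients are extracted first in `x`, then in `y`. The factor `(-y)^d` can be cancelled only
for `y ≠ 0`, which is why the extraction in `y` uses nonzero points only. -/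
theorem eq_zero_of_forall_dblEval [CharZero F] (f : DoubleAff A)
    (h : ∀ (i : Fin 2) (x y : F), dblEval F A i x y f = 0) : f = 0 := by
  obtain ⟨M, hM⟩ : ∃ M, ∀ a ∈ f.support, a.2.1 < M ∧ a.2.2 < M := by
    refine ⟨f.support.sup (fun a => a.2.1 + a.2.2) + 1, fun a ha => ?_⟩
    have := Finset.le_sup (f := fun a : Fin 2 × ℕ × ℕ => a.2.1 + a.2.2) ha
    omega
  have hexp : ∀ (i : Fin 2) (x y : F), dblEval F A i x y f = ∑ m ∈ Finset.range M,
      ∑ n ∈ Finset.range M, ((-y) ^ kd0 i * (divPow x m * divPow y n)) • f (i, m, n) := by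
    intro i x y
    rw [dblEval, Finsupp.lsum_apply, Finsupp.sum_of_support_subset f
      (s := Finset.univ ×ˢ (Finset.range M ×ˢ Finset.range M)), Finset.sum_product,
      Finset.sum_eq_single i]
    · rw [Finset.sum_product]
      simp
    · intro j _ hj
      refine Finset.sum_eq_zero fun b _ => ?_
      simp [hj]
    · simp
    · intro a ha
      simpa using hM a ha
    · simp
  ext ⟨i, m, n⟩
  by_cases hmn : m < M ∧ n < M
  swap
  · by_contra hne
    exact hmn (hM _ (Finsupp.mem_support_iff.2 hne))
  have h1 : ∀ y : F, y ≠ 0 → ∑ n ∈ Finset.range M, divPow y n • f (i, m, n) = 0 := by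
    intro y hy
    refine coeff_eq_of_forall_sum_divPow_smul (F := F) M
      (fun m => ∑ n ∈ Finset.range M, divPow y n • f (i, m, n)) 0 (fun x => ?_) m hmn.1
    have := h i x y
    rw [hexp] at this
    simp only [mul_smul, ← Finset.smul_sum] at this
    rw [smul_eq_zero_iff_right (pow_ne_zero _ (neg_ne_zero.2 hy))] at this
    simpa using this
  have hf : ((n.factorial : ℕ) : F) ≠ 0 := by exact_mod_cast n.factorial_ne_zero
  have h2 := coeff_eq_zero_of_forall_sum_pow_smul (F := F) M
    (fun n => ((n.factorial : ℕ) : F)⁻¹ • f (i, m, n)) (fun y hy => by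
      rw [← h1 y hy]
      exact Finset.sum_congr rfl fun n _ => by rw [smul_smul, divPow, div_eq_mul_inv]) n hmn.2
  rwa [smul_eq_zero_iff_right (inv_ne_zero hf)] at h2

/-! ### The generating function of the products -/

/-- The `z`-bracket in terms of the polynomials attached to `f` and `g`. -/
noncomputable def evalBracket (i : Fin 2) (x y z : F) (f g : DoubleAff A) : A :=
  dblEval F A i x (-z - x) f * dblEval F A i (x + z) y g -
    dblEval F A i x (y + z) g * dblEval F A i (-z - y) y f

theorem sum_range_ite_add_eq {M : Type*} [AddCommMonoid M] (K N : ℕ) (f : ℕ → M) :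
    (∑ p ∈ Finset.range (K + 1), if p + N = K then f p else 0) =
      if N ≤ K then f (K - N) else 0 := by
  split_ifs with h
  · rw [Finset.sum_eq_single (K - N)]
    · rw [if_pos (by omega)]
    · intro b _ hb
      rw [if_neg (by omega)]
    · intro hb
      rw [Finset.mem_range] at hb
      omega
  · refine Finset.sum_eq_zero fun p _ => ?_
    rw [if_neg (by omega)]

theorem dblCoeff_self {A : Type*} [Ring A] (N : ℕ) (i : Fin 2) (u : A) (m₁ m₂ : ℕ) (v : A)
    (n₁ n₂ : ℕ) : dblCoeff N i u m₁ m₂ i v n₁ n₂ =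
      (if N ≤ m₁ + m₂ + n₁ + kd0 i then
        (((n₁ : ℤ) * kd0 i + 1) * Ring.choose (-(n₁ : ℤ) - 1 - kd0 i) m₂ *
          (Nat.choose (m₁ + m₂ + n₁ + kd0 i - N) m₁ : ℤ)) •
          dblElt i (u * v) (m₁ + m₂ + n₁ + kd0 i - N) n₂ else 0) -
      (if N ≤ m₁ + m₂ + n₂ + kd0 i then
        (((1 - kd0 i : ℤ) - ((n₂ : ℤ) + 1) * kd0 i) *
          Ring.choose (-(n₂ : ℤ) - 1 - kd0 i) m₁ *
          (Nat.choose (m₁ + m₂ + n₂ + kd0 i - N) m₂ : ℤ)) •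
          dblElt i (v * u) n₁ (m₁ + m₂ + n₂ + kd0 i - N) else 0) := by
  rw [dblCoeff, if_pos rfl, sum_range_ite_add_eq _ _
    (fun p => (((n₁ : ℤ) * kd0 i + 1) * Ring.choose (-(n₁ : ℤ) - 1 - kd0 i) m₂ *
      (Nat.choose p m₁ : ℤ)) • dblElt i (u * v) p n₂),
    sum_range_ite_add_eq _ _ (fun q => (((1 - kd0 i : ℤ) - ((n₂ : ℤ) + 1) * kd0 i) *
          Ring.choose (-(n₂ : ℤ) - 1 - kd0 i) m₁ * (Nat.choose q m₂ : ℤ)) •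
          dblElt i (v * u) n₁ q)]

theorem choose_neg_sub (n d m : ℕ) :
    Ring.choose (-(n : ℤ) - 1 - d) m = (-1) ^ m * ((n + d + m).choose m : ℤ) := by
  have h1 : -(n : ℤ) - 1 - d = -((n + d + 1 : ℕ) : ℤ) := by push_cast; ring
  have h2 : ((n + d + 1 : ℕ) : ℤ) + (m : ℤ) - 1 = ((n + d + m : ℕ) : ℤ) := by push_cast; ring
  rw [h1, Ring.choose_neg, h2, Ring.choose_natCast]
  simp [Units.smul_def, Int.negOnePow_def]

theorem choose_mul_divPow_add [CharZero F] (x : F) (m k : ℕ) :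
    (((m + k).choose m : ℕ) : F) * divPow x (m + k) = divPow x m * divPow x k := by
  have h0 : (((m + k).factorial : ℕ) : F) ≠ 0 := by exact_mod_cast (m + k).factorial_ne_zero
  have h1 : ((m.factorial : ℕ) : F) ≠ 0 := by exact_mod_cast m.factorial_ne_zero
  have h2 : ((k.factorial : ℕ) : F) ≠ 0 := by exact_mod_cast k.factorial_ne_zero
  have h4 : ((((m + k).choose m : ℕ) : F)) * (m.factorial : F) * (k.factorial : F)
    = ((m + k).factorial : F) := by
    rw [← Nat.add_choose_mul_factorial_mul_factorial m k, Nat.choose_symm_add]; push_cast; ring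
  rw [divPow, divPow, divPow, div_mul_div_comm, mul_div_assoc', div_eq_div_iff h0 (mul_ne_zero h1 h2),
    ← h4]
  ring

/-- This is the binomial expansion of `divPow (x + z) K`, multiplied by `divPow x m`. The terms with
`n > K` are harmless since `(m + K - n).choose m = 0` there. -/
theorem sum_divPow_choose [CharZero F] (x z : F) (m K : ℕ) :
    ∑ n ∈ Finset.range (m + K + 1), divPow z n * ((((m + K - n).choose m : ℕ) : F) *
      divPow x (m + K - n)) = divPow x m * divPow (x + z) K := by
  rw [add_comm x z, divPow_add, Finset.Nat.sum_antidiagonal_eq_sum_range_succ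
    (fun a b => divPow z a * divPow x b), Finset.mul_sum]
  symm
  refine Finset.sum_subset_zero_on_sdiff (Finset.range_mono (by omega)) ?_ ?_
  · intro n hn
    simp only [Finset.mem_sdiff, Finset.mem_range] at hn
    rw [Nat.choose_eq_zero_of_lt (by omega)]
    simp
  · intro n hn
    rw [Finset.mem_range] at hn
    have : m + K - n = m + (K - n) := by omega
    rw [this, choose_mul_divPow_add]
    ring

theorem sum_divPow_choose' [CharZero F] (x z : F) (m K N : ℕ) (hN : m + K < N) :
    (∑ n ∈ Finset.range N, if n ≤ m + K then divPow z n * ((((m + K - n).choose m : ℕ) : F) *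
      divPow x (m + K - n)) else 0) = divPow x m * divPow (x + z) K := by
  rw [← sum_divPow_choose, ← Finset.sum_filter]
  refine Finset.sum_congr ?_ fun _ _ => rfl
  ext n
  simp only [Finset.mem_filter, Finset.mem_range]
  omega

theorem divPow_neg (w : F) (m : ℕ) : divPow (-w) m = (-1) ^ m * divPow w m := by
  rw [divPow, divPow, neg_pow, mul_div_assoc]

/-- With `w = x + z`, the right side is the scalar by which the second variable of the left factor,
at `-w`, meets the first variable of the right factor, at `w`. For `i = 0` the extra `n + 1` in the
structure constant turns into the factor `w`, which accounts for the `(-y)^d` in `dblEval`. -/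
theorem contraction_coeff_mul_divPow [CharZero F] (i : Fin 2) (w : F) (n m : ℕ) :
    (((((n : ℤ) * kd0 i + 1) * Ring.choose (-(n : ℤ) - 1 - kd0 i) m : ℤ)) : F) *
      divPow w (m + n + kd0 i) = w ^ kd0 i * divPow (-w) m * divPow w n := by
  have h := choose_mul_divPow_add w m (n + kd0 i)
  have hd : ((n : F) * kd0 i + 1) * divPow w (n + kd0 i) = w ^ kd0 i * divPow w n := by
    fin_cases i
    · simpa [kd0] using divPow_succ w n
    · simp [kd0]
  rw [choose_neg_sub, divPow_neg, add_comm (n + kd0 i) m, ← add_assoc]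
  rw [← add_assoc] at h
  push_cast
  linear_combination ((n : F) * kd0 i + 1) * (-1) ^ m * h + (-1) ^ m * divPow w m * hd

theorem contraction_coeff_mul_divPow' [CharZero F] (i : Fin 2) (w : F) (n m : ℕ) :
    (((((1 - kd0 i : ℤ) - ((n : ℤ) + 1) * kd0 i) *
      Ring.choose (-(n : ℤ) - 1 - kd0 i) m : ℤ)) : F) *
      divPow w (m + n + kd0 i) = (-w) ^ kd0 i * divPow (-w) m * divPow w n := by
  have h := contraction_coeff_mul_divPow i w n m
  have hd : ((1 - kd0 i : ℤ) - ((n : ℤ) + 1) * kd0 i) =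
      (-1) ^ kd0 i * ((n : ℤ) * kd0 i + 1) := by
    fin_cases i
    · simp [kd0]
    · simp [kd0]
  rw [hd, neg_pow w]
  push_cast at h ⊢
  linear_combination (-1) ^ kd0 i * h

theorem sum_divPow_smul_dblEval_dblP_dblElt [CharZero F] (i : Fin 2) (x y z : F)
    (u : A) (m₁ m₂ : ℕ) (v : A) (n₁ n₂ : ℕ) (N : ℕ) (hN : m₁ + m₂ + n₁ + n₂ + kd0 i < N) :
    ∑ n ∈ Finset.range N, divPow z n • dblEval F A i x y
      (dblP F A n (dblElt i u m₁ m₂) (dblElt i v n₁ n₂)) =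
      evalBracket i x y z (dblElt i u m₁ m₂) (dblElt i v n₁ n₂) := by
  have e1 : m₁ + m₂ + n₁ + kd0 i = m₁ + (m₂ + n₁ + kd0 i) := by ring
  have e2 : m₁ + m₂ + n₂ + kd0 i = m₂ + (m₁ + n₂ + kd0 i) := by ring
  have s1 := sum_divPow_choose' x z m₁ (m₂ + n₁ + kd0 i) N (by omega)
  have s2 := sum_divPow_choose' y z m₂ (m₁ + n₂ + kd0 i) N (by omega)
  have c1 := contraction_coeff_mul_divPow i (x + z) n₁ m₂
  have c2 := contraction_coeff_mul_divPow' i (y + z) n₂ m₁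
  have x1 : -(-z - x) = x + z := by ring
  have x2 : -z - x = -(x + z) := by ring
  have x3 : -z - y = -(y + z) := by ring
  simp only [evalBracket, dblEval_dblElt_self, dblP_dblElt, dblCoeff_self, map_sub, smul_sub,
    Finset.sum_sub_distrib, smul_mul_smul_comm, e1, e2]
  congr 1
  · trans (((((n₁ : ℤ) * kd0 i + 1) * Ring.choose (-(n₁ : ℤ) - 1 - kd0 i) m₂ : ℤ) : F) *
      ((-y) ^ kd0 i * divPow y n₂) * (divPow x m₁ * divPow (x + z) (m₂ + n₁ + kd0 i))) • (u * v)
    · rw [← s1, Finset.mul_sum, Finset.sum_smul]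
      refine Finset.sum_congr rfl fun n _ => ?_
      split_ifs
      · rw [map_zsmul, dblEval_dblElt_self, ← Int.cast_smul_eq_zsmul F, smul_smul, smul_smul]
        congr 1
        push_cast
        ring
      · simp
    · congr 1
      rw [x1, x2]
      linear_combination ((-y) ^ kd0 i * divPow y n₂ * divPow x m₁) * c1
  · trans (((((1 - kd0 i : ℤ) - ((n₂ : ℤ) + 1) * kd0 i) *
      Ring.choose (-(n₂ : ℤ) - 1 - kd0 i) m₁ : ℤ) : F) *
      ((-y) ^ kd0 i * divPow x n₁) * (divPow y m₂ * divPow (y + z) (m₁ + n₂ + kd0 i))) • (v * u)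
    · rw [← s2, Finset.mul_sum, Finset.sum_smul]
      refine Finset.sum_congr rfl fun n _ => ?_
      split_ifs
      · rw [map_zsmul, dblEval_dblElt_self, ← Int.cast_smul_eq_zsmul F, smul_smul, smul_smul]
        congr 1
        push_cast
        ring
      · simp
    · congr 1
      rw [x3]
      linear_combination ((-y) ^ kd0 i * divPow y m₂ * divPow x n₁) * c2

/-- Extends the computation on basis elements by bilinearity. The bound `N₀` makes the generating
series a finite sum, with a value independent of the cut-off. -/
theorem exists_sum_divPow_smul_dblEval_dblP [CharZero F] (f g : DoubleAff A) :
    ∃ N₀ : ℕ, (∀ n, N₀ ≤ n → dblP F A n f g = 0) ∧ ∀ (N : ℕ), N₀ ≤ N → ∀ (i : Fin 2) (x y z : F),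
      ∑ n ∈ Finset.range N, divPow z n • dblEval F A i x y (dblP F A n f g) =
        evalBracket i x y z f g := by
  induction f using dblElt_induction with
  | h0 => exact ⟨0, by simp, by simp [evalBracket]⟩
  | hadd f f' hf hf' =>
    obtain ⟨N, h1, h2⟩ := hf
    obtain ⟨N', h1', h2'⟩ := hf'
    refine ⟨max N N', fun n hn => ?_, fun n hn i x y z => ?_⟩
    · rw [map_add, LinearMap.add_apply, h1 n (by omega), h1' n (by omega), add_zero]
    · simp only [map_add, LinearMap.add_apply, smul_add, Finset.sum_add_distrib]
      rw [h2 n (by omega), h2' n (by omega)]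
      simp only [evalBracket, map_add, add_mul, mul_add]
      abel
  | helt j u m₁ m₂ =>
    induction g using dblElt_induction with
    | h0 => exact ⟨0, by simp, by simp [evalBracket]⟩
    | hadd f f' hf hf' =>
      obtain ⟨N, h1, h2⟩ := hf
      obtain ⟨N', h1', h2'⟩ := hf'
      refine ⟨max N N', fun n hn => ?_, fun n hn i x y z => ?_⟩
      · rw [map_add, h1 n (by omega), h1' n (by omega), add_zero]
      · simp only [map_add, smul_add, Finset.sum_add_distrib]
        rw [h2 n (by omega), h2' n (by omega)]
        simp only [evalBracket, map_add, add_mul, mul_add]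
        abel
    | helt j' v n₁ n₂ =>
      by_cases hj : j = j'
      · subst hj
        refine ⟨m₁ + m₂ + n₁ + n₂ + kd0 j + 1, fun n hn => ?_, fun n hn i x y z => ?_⟩
        · rw [dblP_dblElt, dblCoeff_self, if_neg (by omega), if_neg (by omega), sub_zero]
        · by_cases hij : j = i
          · subst hij
            exact sum_divPow_smul_dblEval_dblP_dblElt j x y z u m₁ m₂ v n₁ n₂ n (by omega)
          · simp only [evalBracket, dblEval_dblElt, if_neg hij, dblP_dblElt, dblCoeff_self]
            simp only [zero_smul, mul_zero, sub_zero]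
            refine Finset.sum_eq_zero fun n _ => ?_
            rw [map_sub]
            split_ifs <;> simp [dblEval_dblElt, hij]
      · refine ⟨0, fun n _ => ?_, fun n _ i x y z => ?_⟩
        · rw [dblP_dblElt, dblCoeff, if_neg hj]
        · simp only [evalBracket, dblEval_dblElt, dblP_dblElt, dblCoeff, if_neg hj]
          by_cases hij : j = i
          · have : j' ≠ i := fun h => hj (hij.trans h.symm)
            simp [this]
          · simp [hij]
theorem evalBracket_sum_right (i : Fin 2) (x y z w : F) (f : DoubleAff A) (g : ℕ → DoubleAff A)
    (N : ℕ) :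
    ∑ n ∈ Finset.range N, divPow w n • evalBracket i x y z f (g n) =
      dblEval F A i x (-z - x) f *
        (∑ n ∈ Finset.range N, divPow w n • dblEval F A i (x + z) y (g n)) -
      (∑ n ∈ Finset.range N, divPow w n • dblEval F A i x (y + z) (g n)) *
        dblEval F A i (-z - y) y f := by
  simp only [evalBracket, smul_sub, Finset.sum_sub_distrib, Finset.mul_sum, Finset.sum_mul,
    smul_mul_assoc, mul_smul_comm]

theorem evalBracket_sum_left (i : Fin 2) (x y z w : F) (g : DoubleAff A) (f : ℕ → DoubleAff A)
    (N : ℕ) :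
    ∑ n ∈ Finset.range N, divPow w n • evalBracket i x y z (f n) g =
      (∑ n ∈ Finset.range N, divPow w n • dblEval F A i x (-z - x) (f n)) *
        dblEval F A i (x + z) y g -
      dblEval F A i x (y + z) g *
        (∑ n ∈ Finset.range N, divPow w n • dblEval F A i (-z - y) y (f n)) := by
  simp only [evalBracket, smul_sub, Finset.sum_sub_distrib, Finset.mul_sum, Finset.sum_mul,
    smul_mul_assoc, mul_smul_comm]

end Eval

/-! ### Generating functions of the right sides of the axioms -/

/-- Since `binom(m, i) z^m/m! = (z^i/i!) (z^(m-i)/(m-i)!)`, collecting the terms with `m + n - i =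
k` gives `(z + w)^k/k!`. For nonzero terms `i` and `m - i` are both below `N`, hence the cut-off `2
* N`. -/
theorem sum_divPow_smul_choose_smul {F : Type*} [Field F] [CharZero F] {A : Type*}
    [AddCommGroup A] [Module F A] (c : ℕ → ℕ → A) (N M : ℕ) (hM : 2 * N ≤ M)
    (hc : ∀ i k, c i k ≠ 0 → i < N ∧ k < N) (z w : F) :
    ∑ m ∈ Finset.range M, ∑ n ∈ Finset.range M, (divPow z m * divPow w n) •
      ∑ i ∈ Finset.range (m + 1), ((m.choose i : ℕ) : F) • c i (m + n - i) =
    ∑ i ∈ Finset.range N, ∑ k ∈ Finset.range N, (divPow z i * divPow (z + w) k) • c i k := by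
  simp only [divPow_add, Finset.mul_sum, Finset.sum_smul, Finset.smul_sum, smul_smul]
  rw [← Finset.sum_product', ← Finset.sum_product', Finset.sum_sigma', Finset.sum_sigma']
  refine Finset.sum_bij_ne_zero
    (fun a _ _ => ⟨(a.2, a.1.1 + a.1.2 - a.2), (a.1.1 - a.2, a.1.2)⟩) ?_ ?_ ?_ ?_
  · rintro ⟨⟨m, n⟩, i⟩ h hne
    have := hc _ _ (right_ne_zero_of_smul hne)
    simp only [Finset.mem_sigma, Finset.mem_product, Finset.mem_range,
      Finset.HasAntidiagonal.mem_antidiagonal] at h this ⊢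
    omega
  · rintro ⟨⟨m, n⟩, i⟩ h - ⟨⟨m', n'⟩, i'⟩ h' - heq
    simp only [Finset.mem_sigma, Finset.mem_product, Finset.mem_range] at h h'
    simp only [Sigma.mk.injEq, Prod.mk.injEq, heq_eq_eq] at heq ⊢
    omega
  · rintro ⟨⟨i, k⟩, ⟨a, b⟩⟩ h hne
    simp only [Finset.mem_sigma, Finset.mem_product, Finset.mem_range,
      Finset.HasAntidiagonal.mem_antidiagonal] at h
    obtain ⟨⟨hi, hk⟩, rfl⟩ := h
    have e1 : i + a + b - i = a + b := by omega
    have e2 : i + a - i = a := by omega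
    refine ⟨⟨(i + a, b), i⟩, ?_, ?_, ?_⟩
    · simp only [Finset.mem_sigma, Finset.mem_product, Finset.mem_range]
      omega
    · simp only [e1]
      convert hne using 2
      linear_combination divPow w b * choose_mul_divPow_add z i a
    · simp only [e1, e2]
  · rintro ⟨⟨m, n⟩, i⟩ h -
    simp only [Finset.mem_sigma, Finset.mem_product, Finset.mem_range] at h
    obtain ⟨a, rfl⟩ : ∃ a, m = i + a := ⟨m - i, by omega⟩
    have e2 : i + a - i = a := by omega
    simp only [e2]
    congr 1
    linear_combination divPow w n * choose_mul_divPow_add z i a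

/-- Here `s` is the scalar by which `∂` acts after evaluation: the exponential in `∂` shifts the
parameter from `-z` to `-z - s`. -/
theorem sum_divPow_smul_skew {F : Type*} [Field F] [CharZero F] {A : Type*}
    [AddCommGroup A] [Module F A] (c : ℕ → A) (N M : ℕ) (hM : N ≤ M)
    (hc : ∀ k, c k ≠ 0 → k < N) (z s : F) :
    ∑ n ∈ Finset.range M, divPow z n • ∑ j ∈ Finset.range N,
      ((-1 : F) ^ (n + j + 1) * ((Nat.factorial j : ℕ) : F)⁻¹) • s ^ j • c (n + j) =
    -∑ k ∈ Finset.range N, divPow (-z - s) k • c k := by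
  have hz : -z - s = -z + -s := by ring
  simp only [hz, divPow_add, Finset.sum_smul, Finset.smul_sum, smul_smul]
  rw [← Finset.sum_product', Finset.sum_sigma', ← Finset.sum_neg_distrib]
  refine Finset.sum_bij_ne_zero (fun a _ _ => ⟨a.1 + a.2, a⟩) ?_ ?_ ?_ ?_
  · rintro ⟨n, j⟩ h hne
    have := hc _ (right_ne_zero_of_smul hne)
    simpa using this
  · rintro a - - b - - heq
    simp only [Sigma.mk.injEq, heq_eq_eq] at heq
    exact heq.2
  · rintro ⟨k, ⟨a, b⟩⟩ h hne
    simp only [Finset.mem_sigma, Finset.mem_range,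
      Finset.HasAntidiagonal.mem_antidiagonal] at h
    obtain ⟨hk, rfl⟩ := h
    refine ⟨(a, b), ?_, ?_, rfl⟩
    · simp only [Finset.mem_product, Finset.mem_range]
      omega
    · intro h0
      apply hne
      rw [← h0, ← neg_smul, divPow_neg, divPow_neg, divPow, divPow]
      congr 1
      ring
  · rintro ⟨n, j⟩ - -
    rw [← neg_smul, divPow_neg, divPow_neg, divPow, divPow]
    congr 1
    ring

/-! ### The axioms of a conformal algebra -/

section
variable {F : Type*} [Field F] [CharZero F] {A : Type*} [Ring A] [Algebra F A]

theorem eq_of_forall_dblEval (f g : DoubleAff A)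
    (h : ∀ (i : Fin 2) (x y : F), dblEval F A i x y f = dblEval F A i x y g) : f = g :=
  sub_eq_zero.1 (eq_zero_of_forall_dblEval (F := F) _ fun i x y => by rw [map_sub, h, sub_self])

theorem eq_of_forall_sum_divPow_smul_dblEval (N : ℕ) (a b : ℕ → DoubleAff A)
    (h : ∀ (i : Fin 2) (x y z : F),
      ∑ n ∈ Finset.range N, divPow z n • dblEval F A i x y (a n) =
        ∑ n ∈ Finset.range N, divPow z n • dblEval F A i x y (b n)) (n : ℕ) (hn : n < N) :
    a n = b n :=
  eq_of_forall_dblEval (F := F) _ _ fun i x y =>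
    coeff_eq_of_forall_sum_divPow_smul (F := F) N (fun n => dblEval F A i x y (a n))
      (fun n => dblEval F A i x y (b n)) (h i x y) n hn

theorem eq_of_forall_sum_sum_divPow_smul_dblEval (N : ℕ) (a b : ℕ → ℕ → DoubleAff A)
    (h : ∀ (i : Fin 2) (x y z w : F),
      ∑ m ∈ Finset.range N, ∑ n ∈ Finset.range N,
          (divPow z m * divPow w n) • dblEval F A i x y (a m n) =
        ∑ m ∈ Finset.range N, ∑ n ∈ Finset.range N,
          (divPow z m * divPow w n) • dblEval F A i x y (b m n))
    (m n : ℕ) (hm : m < N) (hn : n < N) : a m n = b m n := by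
  refine eq_of_forall_sum_divPow_smul_dblEval (F := F) N (a m) (b m) (fun i x y w => ?_) n hn
  refine coeff_eq_of_forall_sum_divPow_smul (F := F) N
    (fun m => ∑ n ∈ Finset.range N, divPow w n • dblEval F A i x y (a m n))
    (fun m => ∑ n ∈ Finset.range N, divPow w n • dblEval F A i x y (b m n)) (fun z => ?_) m hm
  simpa only [Finset.smul_sum, smul_smul] using h i x y z w

/-- An eventually constant sequence has finitely many values, so pointwise bounds become uniform;
this is needed to cut off iterated products. -/
theorem exists_bound_of_eventually_zero {α : Type*} (p : α → ℕ → Prop) (g : ℕ → α) (a₀ : α) (N₀ : ℕ)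
    (hg : ∀ n, N₀ ≤ n → g n = a₀) (hp : ∀ a, ∃ B, ∀ m, B ≤ m → p a m) :
    ∃ M, ∀ n m, M ≤ m → p (g n) m := by
  choose B hB using hp
  refine ⟨max (B a₀) ((Finset.range N₀).sup fun n => B (g n)), fun n m hm => hB _ _ ?_⟩
  by_cases hn : n < N₀
  · have := Finset.le_sup (f := fun n => B (g n)) (Finset.mem_range.2 hn)
    omega
  · rw [hg n (by omega)]
    omega

theorem dblP_jacobi (m n : ℕ) (u v w : DoubleAff A) :
    dblP F A m u (dblP F A n v w) - dblP F A n v (dblP F A m u w) =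
      ∑ i ∈ Finset.range (m + 1), ((Nat.choose m i : ℕ) : F) •
        dblP F A (m + n - i) (dblP F A i u v) w := by
  have bound : ∀ f g : DoubleAff A, ∃ B, ∀ N, B ≤ N → (dblP F A N f g = 0 ∧
      ∀ (i : Fin 2) (x y z : F), ∑ n ∈ Finset.range N, divPow z n •
        dblEval F A i x y (dblP F A n f g) = evalBracket i x y z f g) := fun f g => by
    obtain ⟨B, h1, h2⟩ := exists_sum_divPow_smul_dblEval_dblP (F := F) f g
    exact ⟨B, fun N hN => ⟨h1 N hN, h2 N hN⟩⟩
  obtain ⟨B₁, h₁⟩ := bound v w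
  obtain ⟨B₂, h₂⟩ := bound u w
  obtain ⟨B₃, h₃⟩ := bound u v
  obtain ⟨C₁, g₁⟩ := exists_bound_of_eventually_zero _ (fun n => dblP F A n v w) 0 B₁
    (fun n hn => (h₁ n hn).1) (bound u)
  obtain ⟨C₂, g₂⟩ := exists_bound_of_eventually_zero _ (fun n => dblP F A n u w) 0 B₂
    (fun n hn => (h₂ n hn).1) (bound v)
  obtain ⟨C₃, g₃⟩ := exists_bound_of_eventually_zero _ (fun n => dblP F A n u v) 0 B₃
    (fun n hn => (h₃ n hn).1) (fun f => bound f w)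
  obtain ⟨N, hN⟩ : ∃ N, N = B₁ + B₂ + B₃ + C₁ + C₂ + C₃ := ⟨_, rfl⟩
  -- `M` must exceed the indices `m` and `n` under study as well as twice the common cut-off, for
  -- the reindexing of the double sum.
  obtain ⟨M, hM⟩ : ∃ M, M = 2 * N + m + n + 1 := ⟨_, rfl⟩
  refine eq_of_forall_sum_sum_divPow_smul_dblEval (F := F) M
    (fun m n => dblP F A m u (dblP F A n v w) - dblP F A n v (dblP F A m u w))
    (fun m n => ∑ i ∈ Finset.range (m + 1), ((Nat.choose m i : ℕ) : F) •
        dblP F A (m + n - i) (dblP F A i u v) w)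
    (fun i x y z t => ?_) m n (by omega) (by omega)
  have t1 : ∑ m ∈ Finset.range M, ∑ n ∈ Finset.range M, (divPow z m * divPow t n) •
      dblEval F A i x y (dblP F A m u (dblP F A n v w)) =
      dblEval F A i x (-z - x) u * evalBracket i (x + z) y t v w -
        evalBracket i x (y + z) t v w * dblEval F A i (-z - y) y u := by
    rw [Finset.sum_comm, ← (h₁ M (by omega)).2, ← (h₁ M (by omega)).2, ← evalBracket_sum_right]
    refine Finset.sum_congr rfl fun n _ => ?_
    rw [← (g₁ n M (by omega)).2, Finset.smul_sum]
    exact Finset.sum_congr rfl fun m _ => by rw [smul_smul, mul_comm]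
  have t2 : ∑ m ∈ Finset.range M, ∑ n ∈ Finset.range M, (divPow z m * divPow t n) •
      dblEval F A i x y (dblP F A n v (dblP F A m u w)) =
      dblEval F A i x (-t - x) v * evalBracket i (x + t) y z u w -
        evalBracket i x (y + t) z u w * dblEval F A i (-t - y) y v := by
    rw [← (h₂ M (by omega)).2, ← (h₂ M (by omega)).2, ← evalBracket_sum_right]
    refine Finset.sum_congr rfl fun n _ => ?_
    rw [← (g₂ n M (by omega)).2, Finset.smul_sum]
    exact Finset.sum_congr rfl fun m _ => by rw [smul_smul]
  have t3 : ∑ i' ∈ Finset.range N, ∑ k ∈ Finset.range N, (divPow z i' * divPow (z + t) k) •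
      dblEval F A i x y (dblP F A k (dblP F A i' u v) w) =
      evalBracket i x (-(z + t) - x) z u v * dblEval F A i (x + (z + t)) y w -
        dblEval F A i x (y + (z + t)) w * evalBracket i (-(z + t) - y) y z u v := by
    rw [← (h₃ N (by omega)).2, ← (h₃ N (by omega)).2, ← evalBracket_sum_left]
    refine Finset.sum_congr rfl fun n _ => ?_
    rw [← (g₃ n N (by omega)).2, Finset.smul_sum]
    exact Finset.sum_congr rfl fun m _ => by rw [smul_smul]
  simp only [map_sub, smul_sub, Finset.sum_sub_distrib, map_sum, map_smul]
  rw [t1, t2, sum_divPow_smul_choose_smul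
    (fun i' k => dblEval F A i x y (dblP F A k (dblP F A i' u v) w)) N M (by omega), t3]
  -- Once the evaluation points are matched, the mixed terms `u w v` and `v w u` cancel, and
  -- associativity gives the rest.
  · simp only [evalBracket]
    have a1 : x + z + t = x + (z + t) := by ring
    have a2 : x + t + z = x + (z + t) := by ring
    have a3 : y + z + t = y + (z + t) := by ring
    have a4 : y + t + z = y + (z + t) := by ring
    have a5 : -t - (x + z) = -(z + t) - x := by ring
    have a6 : -z - (x + t) = -(z + t) - x := by ring
    have a7 : -t - (y + z) = -(z + t) - y := by ring
    have a8 : -z - (y + t) = -(z + t) - y := by ring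
    have a9 : -z - (-(z + t) - x) = x + t := by ring
    have a10 : -(z + t) - x + z = -t - x := by ring
    have a11 : -(z + t) - y + z = -t - y := by ring
    have a12 : -z - (-(z + t) - y) = y + t := by ring
    simp only [a1, a2, a3, a4, a5, a6, a7, a8, a9, a10, a11, a12]
    noncomm_ring
  · intro i' k hne
    by_contra hcon
    apply hne
    by_cases hi : i' < N
    · rw [(g₃ i' k (by omega)).1, map_zero]
    · rw [(h₃ i' (by omega)).1, map_zero, LinearMap.zero_apply, map_zero]

theorem dblP_skew (n N : ℕ) (u v : DoubleAff A)
    (hN : ∀ m : ℕ, N ≤ m → dblP F A m v u = 0) :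
    dblP F A n u v = ∑ j ∈ Finset.range N,
      ((-1 : F) ^ (n + j + 1) * ((Nat.factorial j : ℕ) : F)⁻¹) •
        (dblD F A ^ j) (dblP F A (n + j) v u) := by
  obtain ⟨B₁, -, h₁⟩ := exists_sum_divPow_smul_dblEval_dblP (F := F) u v
  obtain ⟨B₂, -, h₂⟩ := exists_sum_divPow_smul_dblEval_dblP (F := F) v u
  refine eq_of_forall_sum_divPow_smul_dblEval (F := F) (n + N + B₁ + 1)
    (fun n => dblP F A n u v) (fun n => ∑ j ∈ Finset.range N,
      ((-1 : F) ^ (n + j + 1) * ((Nat.factorial j : ℕ) : F)⁻¹) •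
        (dblD F A ^ j) (dblP F A (n + j) v u)) (fun i x y z => ?_) n (by omega)
  simp only [map_sum, map_smul, dblEval_dblD_pow]
  rw [h₁ _ (by omega), sum_divPow_smul_skew (fun k => dblEval F A i x y (dblP F A k v u)) N _
    (by omega)]
  · have : ∑ k ∈ Finset.range N, divPow (-z - (x + y)) k • dblEval F A i x y (dblP F A k v u) =
        evalBracket i x y (-z - (x + y)) v u := by
      rw [← h₂ (N + B₂) (by omega)]
      refine Finset.sum_subset (Finset.range_mono (by omega)) fun k _ hk => ?_
      rw [hN k (by simpa using hk), map_zero, smul_zero]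
    rw [this]
    simp only [evalBracket]
    -- The substitution of `-z - (x + y)` for `z` exchanges the two terms of the bracket, hence
    -- changes its sign when `u` and `v` are swapped.
    have a1 : -(-z - (x + y)) - x = y + z := by ring
    have a2 : x + (-z - (x + y)) = -z - y := by ring
    have a3 : y + (-z - (x + y)) = -z - x := by ring
    have a4 : -(-z - (x + y)) - y = x + z := by ring
    rw [a1, a2, a3, a4, neg_sub]
  · intro k hk
    by_contra hcon
    exact hk (by rw [hN k (by omega), map_zero])

theorem dblP_dblD_left (u v : DoubleAff A) :
    dblP F A 0 (dblD F A u) v = 0 ∧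
      ∀ n, dblP F A (n + 1) (dblD F A u) v = -((n : F) + 1) • dblP F A n u v := by
  obtain ⟨B₁, h₀, h₁⟩ := exists_sum_divPow_smul_dblEval_dblP (F := F) u v
  obtain ⟨B₂, -, h₂⟩ := exists_sum_divPow_smul_dblEval_dblP (F := F) (dblD F A u) v
  -- At `n = 0` the truncated index `n - 1` is harmless, because its coefficient vanishes; both
  -- parts of the claim thus become one formula.
  have key : ∀ n, dblP F A n (dblD F A u) v =
      -(n : F) • dblP F A (n - 1) u v := by
    intro n
    refine eq_of_forall_sum_divPow_smul_dblEval (F := F) (n + B₁ + B₂ + 1 + 1)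
      (fun n => dblP F A n (dblD F A u) v) (fun n => -(n : F) • dblP F A (n - 1) u v)
      (fun i x y z => ?_) n (by omega)
    rw [h₂ _ (by omega), Finset.sum_range_succ']
    simp only [Nat.add_sub_cancel, Nat.cast_zero, neg_zero, zero_smul, map_zero, smul_zero,
      add_zero, map_smul]
    trans (-z) • evalBracket i x y z u v
    · simp only [evalBracket, dblEval_dblD]
      have a1 : x + (-z - x) = -z := by ring
      have a2 : -z - y + y = -z := by ring
      rw [a1, a2, smul_sub, smul_mul_assoc, mul_smul_comm]
    · rw [← h₁ (n + B₁ + B₂ + 1) (by omega), Finset.smul_sum]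
      refine Finset.sum_congr rfl fun k _ => ?_
      rw [smul_smul, smul_smul]
      congr 1
      push_cast
      linear_combination divPow_succ z k
  refine ⟨by simpa using key 0, fun n => by simpa using key (n + 1)⟩

theorem isConformalAlgebra_dbl :
    IsConformalAlgebra F (dblD F A) (dblP F A) where
  finite u v := by
    obtain ⟨N, h, -⟩ := exists_sum_divPow_smul_dblEval_dblP (F := F) u v
    exact ⟨N, h⟩
  deriv_zero u v := (dblP_dblD_left u v).1
  deriv_succ n u v := (dblP_dblD_left u v).2 n
  skew := dblP_skew
  jacobi := dblP_jacobi
end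

/-! ### Subalgebras and simplicity -/

/-- The span of the elements `u_{[i,i]}(m, n)` with `n ≥ r`. -/
noncomputable def dblSpan (F : Type*) [Field F] (A : Type*) [Ring A] [Algebra F A] (i : Fin 2)
    (r : ℕ) : Submodule F (DoubleAff A) :=
  Submodule.span F {x | ∃ (u : A) (m n : ℕ), r ≤ n ∧ x = dblElt i u m n}

section
variable {F : Type*} [Field F] {A : Type*} [Ring A] [Algebra F A]

theorem dblElt_mem_dblSpan (i : Fin 2) {r : ℕ} (u : A) (m : ℕ) {n : ℕ} (h : r ≤ n) :
    dblElt i u m n ∈ dblSpan F A i r :=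
  Submodule.subset_span ⟨u, m, n, h, rfl⟩

theorem support_of_mem_dblSpan {i : Fin 2} {r : ℕ} {f : DoubleAff A} (hf : f ∈ dblSpan F A i r)
    (a : Fin 2 × ℕ × ℕ) (ha : a ∈ f.support) : a.1 = i ∧ r ≤ a.2.2 := by
  rw [Finsupp.mem_support_iff] at ha
  by_contra hcon
  apply ha
  induction hf using Submodule.span_induction with
  | mem x hx =>
    obtain ⟨u, m, n, hn, rfl⟩ := hx
    rw [dblElt, Finsupp.single_apply, if_neg]
    rintro rfl
    exact hcon ⟨rfl, hn⟩
  | zero => rfl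
  | add x y _ _ hx hy =>
    by_cases h1 : x a = 0
    · by_cases h2 : y a = 0
      · rw [Finsupp.add_apply, h1, h2, add_zero]
      · exact absurd (hy h2) h2
    · exact absurd (hx h1) h1
  | smul c x _ hx =>
    by_cases h1 : x a = 0
    · rw [Finsupp.smul_apply, h1, smul_zero]
    · exact absurd (hx h1) h1

/-- The first half of a product keeps the second index `n₂ ≥ r`. The second half has second index
`q` with coefficient `binom(q, m₂)`, which vanishes unless `q ≥ m₂ ≥ r`. -/
theorem isConformalSubalgebra_dblSpan (i : Fin 2) (r : ℕ) :
    IsConformalSubalgebra (dblD F A) (dblP F A) (dblSpan F A i r) := by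
  refine ⟨fun u hu => ?_, fun N u hu v hv => ?_⟩
  · induction hu using Submodule.span_induction with
    | mem x hx =>
      obtain ⟨u, m, n, hn, rfl⟩ := hx
      rw [dblD_dblElt]
      exact add_mem (Submodule.smul_mem _ _ (dblElt_mem_dblSpan i u _ hn))
        (Submodule.smul_mem _ _ (dblElt_mem_dblSpan i u _ (by omega)))
    | zero => simp
    | add x y _ _ hx hy => rw [map_add]; exact add_mem hx hy
    | smul c x _ hx => rw [map_smul]; exact Submodule.smul_mem _ _ hx
  · induction hu using Submodule.span_induction with
    | mem x hx =>
      obtain ⟨u, m₁, m₂, hm, rfl⟩ := hx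
      induction hv using Submodule.span_induction with
      | mem x hx =>
        obtain ⟨v, n₁, n₂, hn, rfl⟩ := hx
        rw [dblP_dblElt, dblCoeff_self]
        refine sub_mem ?_ ?_
        · split_ifs
          · exact zsmul_mem (dblElt_mem_dblSpan i _ _ hn) _
          · exact zero_mem _
        · split_ifs
          · by_cases hq : m₂ ≤ m₁ + m₂ + n₂ + kd0 i - N
            · exact zsmul_mem (dblElt_mem_dblSpan i _ _ (by omega)) _
            · rw [Nat.choose_eq_zero_of_lt (by omega), Nat.cast_zero, mul_zero, zero_smul]
              exact zero_mem _
          · exact zero_mem _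
      | zero => simp
      | add x y _ _ hx hy => rw [map_add]; exact add_mem hx hy
      | smul c x _ hx => rw [map_smul]; exact Submodule.smul_mem _ _ hx
    | zero => simp
    | add x y _ _ hx hy => rw [map_add, LinearMap.add_apply]; exact add_mem hx hy
    | smul c x _ hx => rw [map_smul, LinearMap.smul_apply]; exact Submodule.smul_mem _ _ hx

/-- In the second half `q < m₂`, so `binom(q, m₂) = 0`. In the first half `p ≤ m₁`, with equality
needed for `binom(p, m₁) ≠ 0`. Hence among the elements of first index at most `n`, this product
detects exactly those of first index `n`. -/
theorem dblP_dblElt_of_right_small (i : Fin 2) (u v : A) (m₁ m₂ n₁ n₂ n : ℕ) (hn : n₁ ≤ n)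
    (hm : m₁ + n₂ < m₂) :
    dblP F A (m₂ + n + kd0 i) (dblElt i u m₁ m₂) (dblElt i v n₁ n₂) =
      if n₁ = n then (((n : ℤ) * kd0 i + 1) * Ring.choose (-(n : ℤ) - 1 - kd0 i) m₂) •
        dblElt i (u * v) m₁ n₂ else 0 := by
  rw [dblP_dblElt, dblCoeff_self, Nat.choose_eq_zero_of_lt (n := m₁ + m₂ + n₂ + kd0 i - _)
    (by omega), Nat.cast_zero, mul_zero, zero_smul, ite_self, sub_zero]
  by_cases h : n₁ = n
  · subst h
    have : m₁ + m₂ + n₁ + kd0 i - (m₂ + n₁ + kd0 i) = m₁ := by omega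
    rw [if_pos (by omega), if_pos rfl, this, Nat.choose_self, Nat.cast_one, mul_one]
  · rw [if_neg h]
    split_ifs
    · rw [Nat.choose_eq_zero_of_lt (by omega), Nat.cast_zero, mul_zero, zero_smul]
    · rfl

theorem dblP_dblElt_of_left_small (i : Fin 2) (u v : A) (m₁ m₂ n₁ n₂ n : ℕ) (hn : n₂ ≤ n)
    (hm : m₂ + n₁ < m₁) :
    dblP F A (m₁ + n + kd0 i) (dblElt i u m₁ m₂) (dblElt i v n₁ n₂) =
      -if n₂ = n then (((1 - kd0 i : ℤ) - ((n : ℤ) + 1) * kd0 i) *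
        Ring.choose (-(n : ℤ) - 1 - kd0 i) m₁) • dblElt i (v * u) n₁ m₂ else 0 := by
  rw [dblP_dblElt, dblCoeff_self, Nat.choose_eq_zero_of_lt (n := m₁ + m₂ + n₁ + kd0 i - _)
    (by omega), Nat.cast_zero, mul_zero, zero_smul, ite_self, zero_sub]
  congr 1
  by_cases h : n₂ = n
  · subst h
    have : m₁ + m₂ + n₂ + kd0 i - (m₁ + n₂ + kd0 i) = m₂ := by omega
    rw [if_pos (by omega), if_pos rfl, this, Nat.choose_self, Nat.cast_one, mul_one]
  · rw [if_neg h]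
    split_ifs
    · rw [Nat.choose_eq_zero_of_lt (by omega), Nat.cast_zero, mul_zero, zero_smul]
    · rfl

theorem choose_neg_sub_ne_zero (n d m : ℕ) : Ring.choose (-(n : ℤ) - 1 - d) m ≠ 0 := by
  rw [choose_neg_sub]
  have : (n + d + m).choose m ≠ 0 := (Nat.choose_pos (by omega)).ne'
  exact mul_ne_zero (pow_ne_zero _ (by norm_num)) (by exact_mod_cast this)

theorem contraction_coeff_ne_zero (i : Fin 2) (n m : ℕ) :
    ((n : ℤ) * kd0 i + 1) * Ring.choose (-(n : ℤ) - 1 - kd0 i) m ≠ 0 :=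
  mul_ne_zero (by positivity) (choose_neg_sub_ne_zero n (kd0 i) m)

theorem contraction_coeff_ne_zero' (i : Fin 2) (n m : ℕ) :
    ((1 - kd0 i : ℤ) - ((n : ℤ) + 1) * kd0 i) * Ring.choose (-(n : ℤ) - 1 - kd0 i) m ≠ 0 := by
  refine mul_ne_zero ?_ (choose_neg_sub_ne_zero n (kd0 i) m)
  fin_cases i
  · simp [kd0]
    omega
  · simp [kd0]

theorem mem_of_zsmul_mem [CharZero F] {V : Type*} [AddCommGroup V] [Module F V]
    (I : Submodule F V) {c : ℤ} (hc : c ≠ 0) {x : V} (h : c • x ∈ I) : x ∈ I := by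
  rw [← Int.cast_smul_eq_zsmul F] at h
  exact (I.smul_mem_iff (by exact_mod_cast hc)).1 h

theorem eq_sum_dblElt {i : Fin 2} {r : ℕ} {h : DoubleAff A} (hh : h ∈ dblSpan F A i r) :
    h = ∑ a ∈ h.support, dblElt i (h a) a.2.1 a.2.2 := by
  conv_lhs => rw [← Finsupp.sum_single h]
  refine Finset.sum_congr rfl fun a ha => ?_
  rw [dblElt, ← (support_of_mem_dblSpan hh a ha).1]

/-- A nonzero ideal of `dblSpan F A i r` contains the elements `(u z v)(m, n)` for some `z ≠ 0`. -/
theorem exists_mul_mul_mem_of_ideal [CharZero F] (i : Fin 2) (r : ℕ) (I : Submodule F (DoubleAff A))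
    (hI : IsConformalIdeal (dblD F A) (dblP F A) (dblSpan F A i r) I) (hne : I ≠ ⊥) :
    ∃ z : A, z ≠ 0 ∧ ∀ (u v : A) (m n : ℕ), r ≤ n → dblElt i (u * z * v) m n ∈ I := by
  obtain ⟨hS, -, hP⟩ := hI
  obtain ⟨h, hh, h0⟩ := Submodule.exists_mem_ne_zero_of_ne_bot hne
  obtain ⟨a₀, ha₀, hmax⟩ := Finset.exists_max_image h.support (fun a => a.2.1)
    (Finsupp.support_nonempty_iff.2 h0)
  obtain ⟨B, hB⟩ : ∃ B, ∀ a ∈ h.support, a.2.2 < B :=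
    ⟨h.support.sup (fun a => a.2.2) + 1, fun a ha =>
      Nat.lt_succ_of_le (Finset.le_sup (f := fun a : Fin 2 × ℕ × ℕ => a.2.2) ha)⟩
  -- the part of `h` of highest degree in the first variable
  set g : DoubleAff A :=
    ∑ a ∈ h.support, if a.2.1 = a₀.2.1 then dblElt i (h a) 0 a.2.2 else 0 with hg
  -- The second index `B + r` exceeds every second index in `h` and keeps the multiplier in the
  -- subalgebra.
  have hgI : g ∈ I := by
    have h1 := hP (B + r + a₀.2.1 + kd0 i) (dblElt i 1 0 (B + r))
      (dblElt_mem_dblSpan i _ _ (by omega)) h hh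
    rw [eq_sum_dblElt (hS hh), map_sum] at h1
    refine mem_of_zsmul_mem I (contraction_coeff_ne_zero i a₀.2.1 (B + r)) ?_
    convert h1 using 1
    rw [hg, Finset.smul_sum]
    refine Finset.sum_congr rfl fun a ha => ?_
    rw [dblP_dblElt_of_right_small i _ _ _ _ _ _ _ (hmax a ha) (by have := hB a ha; omega), one_mul]
    split_ifs <;> simp
  have hg0 : g (i, 0, a₀.2.2) = h a₀ := by
    rw [hg, Finsupp.finsetSum_apply, Finset.sum_eq_single a₀]
    · simp [dblElt]
    · intro b hb hba
      split_ifs with hb1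
      · rw [dblElt, Finsupp.single_apply, if_neg]
        intro heq
        apply hba
        have e1 := (support_of_mem_dblSpan (hS hh) b hb).1
        have e2 := (support_of_mem_dblSpan (hS hh) a₀ ha₀).1
        simp only [Prod.mk.injEq, true_and] at heq
        exact Prod.ext (e1.trans e2.symm) (Prod.ext hb1 heq)
      · rfl
    · exact fun h' => absurd ha₀ h'
  have hgm : ∀ a ∈ g.support, a.2.1 = 0 := by
    intro a ha
    by_contra hcon
    rw [Finsupp.mem_support_iff] at ha
    apply ha
    rw [hg, Finsupp.finsetSum_apply]
    refine Finset.sum_eq_zero fun b _ => ?_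
    split_ifs
    · rw [dblElt, Finsupp.single_apply, if_neg]
      rintro rfl
      exact hcon rfl
    · rfl
  have hgne : g ≠ 0 := by
    intro h'
    rw [h', Finsupp.zero_apply] at hg0
    exact (Finsupp.mem_support_iff.1 ha₀) hg0.symm
  obtain ⟨b₀, hb₀, hbmax⟩ := Finset.exists_max_image g.support (fun a => a.2.2)
    (Finsupp.support_nonempty_iff.2 hgne)
  have hzv : ∀ (v : A) (n : ℕ), r ≤ n → dblElt i (g b₀ * v) 0 n ∈ I := by
    intro v n hn
    -- All first indices in `g` are zero, so `n + 1 > n + 0` suffices to kill the first half; only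
    -- the term of top second index survives.
    have h1 := hP (n + 1 + b₀.2.2 + kd0 i) (dblElt i v (n + 1) n)
      (dblElt_mem_dblSpan i _ _ hn) g hgI
    rw [eq_sum_dblElt (hS hgI), map_sum, Finset.sum_eq_single b₀] at h1
    · rw [dblP_dblElt_of_left_small i _ _ _ _ _ _ _ le_rfl (by have := hgm _ hb₀; omega), if_pos rfl,
        hgm _ hb₀] at h1
      exact mem_of_zsmul_mem I (contraction_coeff_ne_zero' i _ _) (neg_mem_iff.1 h1)
    · intro b hb hbb
      rw [dblP_dblElt_of_left_small i _ _ _ _ _ _ _ (hbmax b hb) (by have := hgm _ hb; omega), if_neg,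
        neg_zero]
      intro heq
      apply hbb
      have e1 := (support_of_mem_dblSpan (hS hgI) b hb).1
      have e2 := (support_of_mem_dblSpan (hS hgI) b₀ hb₀).1
      exact Prod.ext (e1.trans e2.symm) (Prod.ext ((hgm b hb).trans (hgm b₀ hb₀).symm) heq)
    · exact fun h' => absurd hb₀ h'
  refine ⟨g b₀, Finsupp.mem_support_iff.1 hb₀, fun u v m n hn => ?_⟩
  -- The second index `m + n + 1` is the least that exceeds `m + n`, so only the first half survives
  -- and `u` multiplies from the left.
  have h1 := hP (m + n + 1 + 0 + kd0 i) (dblElt i u m (m + n + 1))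
    (dblElt_mem_dblSpan i _ _ (by omega)) _ (hzv v n hn)
  rw [dblP_dblElt_of_right_small i _ _ _ _ _ _ _ le_rfl (by omega), if_pos rfl] at h1
  rw [mul_assoc]
  exact mem_of_zsmul_mem I (contraction_coeff_ne_zero i _ _) h1

theorem isSimpleConformal_dblSpan [CharZero F] (i : Fin 2) (r : ℕ)
    (hA : ∀ z : A, z ≠ 0 → Submodule.span F {w | ∃ u v : A, w = u * z * v} = ⊤) :
    IsSimpleConformal (dblD F A) (dblP F A) (dblSpan F A i r) := by
  intro I hI
  by_cases hne : I = ⊥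
  · exact Or.inl hne
  · right
    obtain ⟨z, hz, hmem⟩ := exists_mul_mul_mem_of_ideal i r I hI hne
    refine le_antisymm hI.1 (Submodule.span_le.2 ?_)
    rintro _ ⟨w, m, n, hn, rfl⟩
    have : Submodule.span F {w | ∃ u v : A, w = u * z * v} ≤
        I.comap (Finsupp.lsingle (R := F) (i, m, n)) := by
      rw [Submodule.span_le]
      rintro _ ⟨u, v, rfl⟩
      exact hmem u v m n hn
    exact this ((hA z hz).symm ▸ Submodule.mem_top)
end

/-! ### Matrix algebras -/

/-- If `z a b ≠ 0`, then `E_{ca} z E_{bd}` is `z a b` times `E_{cd}`, so every matrix unit is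
reached. -/
theorem matrix_span_mul_mul_eq_top (F : Type*) [Field F] (k : ℕ) (z : Matrix (Fin k) (Fin k) F)
    (hz : z ≠ 0) : Submodule.span F {w | ∃ u v : Matrix (Fin k) (Fin k) F, w = u * z * v} = ⊤ := by
  obtain ⟨a, b, hab⟩ : ∃ a b, z a b ≠ 0 := by
    by_contra! hcon
    exact hz (Matrix.ext hcon)
  rw [eq_top_iff]
  intro w _
  rw [Matrix.matrix_eq_sum_single w]
  refine sum_mem fun c _ => sum_mem fun d _ => Submodule.subset_span
    ⟨Matrix.single c a 1, Matrix.single b d (w c d * (z a b)⁻¹), ?_⟩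
  rw [Matrix.single_mul_mul_single]
  congr 1
  field_simp

theorem matConf_one (F : Type*) [Field F] (k : ℕ) :
    matConf F k 1 = dblSpan F (Matrix (Fin k) (Fin k) F) 1 0 := by
  simp [matConf, dblSpan]

theorem matConf_add_two (F : Type*) [Field F] (k ℓ : ℕ) :
    matConf F k (ℓ + 2) = dblSpan F (Matrix (Fin k) (Fin k) F) 0 ℓ := rfl

theorem exists_matConf_eq (F : Type*) [Field F] (k ℓ : ℕ) (h : 1 ≤ ℓ) :
    ∃ i r, matConf F k ℓ = dblSpan F (Matrix (Fin k) (Fin k) F) i r := by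
  match ℓ, h with
  | 1, _ => exact ⟨1, 0, matConf_one F k⟩
  | ℓ + 2, _ => exact ⟨0, ℓ, rfl⟩

/-! ### Generation: words and explicit products -/

section
variable {F : Type*} [Field F] {R : Type*} [AddCommGroup R] [Module F R]
  {D : R →ₗ[F] R} {P : ℕ → R →ₗ[F] R →ₗ[F] R}

theorem span_conformalWord_le {S : Submodule F R} (hS : IsConformalSubalgebra D P S) {T : Set R}
    (hT : T ⊆ S) : Submodule.span F {w | ConformalWord P T w} ≤ S := by
  rw [Submodule.span_le]
  intro w hw
  induction hw with
  | base v hv => exact hT hv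
  | step m u w hu _ ih => exact hS.2 m u (hT hu) w ih

theorem mem_span_conformalWord {T : Set R} {v : R} (hv : v ∈ T) :
    v ∈ Submodule.span F {w | ConformalWord P T w} :=
  Submodule.subset_span (ConformalWord.base v hv)

/-- Words grow only on the left and only by generators, so every relation used below has a generator
as its left factor. -/
theorem product_mem_span_conformalWord {T : Set R} (n : ℕ) {u v : R} (hu : u ∈ T)
    (hv : v ∈ Submodule.span F {w | ConformalWord P T w}) :
    P n u v ∈ Submodule.span F {w | ConformalWord P T w} := by
  induction hv using Submodule.span_induction with
  | mem x hx => exact Submodule.subset_span (ConformalWord.step n u x hu hx)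
  | zero => simp
  | add x y _ _ hx hy => rw [map_add]; exact add_mem hx hy
  | smul c x _ hx => rw [map_smul]; exact Submodule.smul_mem _ _ hx
end

section
variable {A : Type*} [Ring A]

theorem dblElt_zero (i : Fin 2) (m n : ℕ) : dblElt i (0 : A) m n = 0 := Finsupp.single_zero _

variable {F : Type*} [Field F] [Algebra F A]

theorem dblElt_smul (i : Fin 2) (c : F) (u : A) (m n : ℕ) :
    dblElt i (c • u) m n = c • dblElt i u m n := (Finsupp.smul_single _ _ _).symm

/-- By Cramer's rule two independent relations yield both neighbours of `(m, n)`; every index pair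
is then reached from `(0, r)` along `n` first and `m` afterwards. -/
theorem dblElt_one_mem_of_two_relations [CharZero F] (W : Submodule F (DoubleAff A)) (i : Fin 2)
    (r : ℕ) (h0 : dblElt i 1 0 r ∈ W)
    (h1 : ∀ m n, r ≤ n → dblElt i 1 m n ∈ W → ∃ α β α' β' : ℤ, α * β' - α' * β ≠ 0 ∧
      α • dblElt i 1 (m + 1) n + β • dblElt i 1 m (n + 1) ∈ W ∧
      α' • dblElt i 1 (m + 1) n + β' • dblElt i 1 m (n + 1) ∈ W) (m n : ℕ) (hn : r ≤ n) :
    dblElt i (1 : A) m n ∈ W := by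
  have key : ∀ m n, r ≤ n → dblElt i 1 m n ∈ W →
      dblElt i (1 : A) (m + 1) n ∈ W ∧ dblElt i (1 : A) m (n + 1) ∈ W := by
    intro m n hn hmem
    obtain ⟨α, β, α', β', hdet, e1, e2⟩ := h1 m n hn hmem
    constructor
    · refine mem_of_zsmul_mem W hdet ?_
      convert sub_mem (zsmul_mem e1 β') (zsmul_mem e2 β) using 1
      module
    · refine mem_of_zsmul_mem W hdet ?_
      convert sub_mem (zsmul_mem e2 α) (zsmul_mem e1 α') using 1
      module
  induction m with
  | zero =>
    induction n, hn using Nat.le_induction with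
    | base => exact h0
    | succ n hn ih => exact (key 0 n hn ih).2
  | succ m ih => exact (key m n hn ih).1

theorem dblP_zero_raise (u v : A) (s m n : ℕ) :
    dblP F A s (dblElt 0 u 0 s) (dblElt 0 v m n) =
      (((m : ℤ) + 1) * ((-1) ^ s * ((m + 1 + s).choose s : ℤ))) • dblElt 0 (u * v) (m + 1) n +
      (((n : ℤ) + 1) * ((n + 1).choose s : ℤ)) • dblElt 0 (v * u) m (n + 1) := by
  have hd : kd0 0 = 1 := rfl
  have e1 : 0 + s + m + 1 - s = m + 1 := by omega
  have e2 : 0 + s + n + 1 - s = n + 1 := by omega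
  rw [dblP_dblElt, dblCoeff_self, choose_neg_sub, hd, if_pos (by omega), if_pos (by omega), e1, e2,
    Ring.choose_zero_right, Nat.choose_zero_right]
  module

theorem dblP_zero_keep (u v : A) (s n : ℕ) :
    dblP F A (s + 1) (dblElt 0 u 0 s) (dblElt 0 v 0 n) =
      ((-1) ^ s * ((s : ℤ) + 1)) • dblElt 0 (u * v) 0 n +
      (((n : ℤ) + 1) * (n.choose s : ℤ)) • dblElt 0 (v * u) 0 n := by
  have hd : kd0 0 = 1 := rfl
  have e1 : 0 + s + 0 + 1 - (s + 1) = 0 := by omega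
  have e2 : 0 + s + n + 1 - (s + 1) = n := by omega
  have e3 : (0 + 1 + s).choose s = s + 1 := by
    rw [zero_add, add_comm, Nat.choose_succ_self_right]
  rw [dblP_dblElt, dblCoeff_self, choose_neg_sub, hd, if_pos (by omega), if_pos (by omega), e1, e2,
    Ring.choose_zero_right, Nat.choose_zero_right, e3]
  push_cast
  module

theorem dblP_one_raise (u v : A) (m n : ℕ) :
    dblP F A 0 (dblElt 1 u 1 0) (dblElt 1 v m n) =
      ((m : ℤ) + 1) • dblElt 1 (u * v) (m + 1) n + ((n : ℤ) + 1) • dblElt 1 (v * u) m (n + 1) := by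
  have hd : kd0 1 = 0 := rfl
  have e1 : 1 + 0 + m + 0 - 0 = m + 1 := by omega
  have e2 : 1 + 0 + n + 0 - 0 = n + 1 := by omega
  rw [dblP_dblElt, dblCoeff_self, hd, if_pos (by omega), if_pos (by omega), e1, e2,
    Ring.choose_zero_right, Nat.choose_zero_right, Ring.choose_one_right, Nat.choose_one_right]
  push_cast
  module

theorem dblP_one_raise' (u v : A) (m n : ℕ) :
    dblP F A 1 (dblElt 1 u 0 2) (dblElt 1 v m n) =
      ((m + 2).choose 2 : ℤ) • dblElt 1 (u * v) (m + 1) n +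
        (-((n + 1).choose 2 : ℤ)) • dblElt 1 (v * u) m (n + 1) := by
  have hd : kd0 1 = 0 := rfl
  have e1 : 0 + 2 + m + 0 - 1 = m + 1 := by omega
  have e2 : 0 + 2 + n + 0 - 1 = n + 1 := by omega
  rw [dblP_dblElt, dblCoeff_self, choose_neg_sub, hd, if_pos (by omega), if_pos (by omega), e1, e2,
    Ring.choose_zero_right, Nat.choose_zero_right]
  push_cast
  module

theorem dblP_one_bottom (u v : A) :
    dblP F A 3 (dblElt 1 u 0 2) (dblElt 1 v 1 0) = (3 : ℤ) • dblElt 1 (u * v) 0 0 := by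
  have hd : kd0 1 = 0 := rfl
  rw [dblP_dblElt, dblCoeff_self, choose_neg_sub, hd, if_pos (by omega), if_neg (by omega)]
  simp [Nat.choose]

theorem dblP_one_keep (u v : A) (n : ℕ) :
    dblP F A 1 (dblElt 1 u 0 1) (dblElt 1 v 0 n) =
      (-1 : ℤ) • dblElt 1 (u * v) 0 n + (-(n : ℤ)) • dblElt 1 (v * u) 0 n := by
  have hd : kd0 1 = 0 := rfl
  have e1 : 0 + 1 + 0 + 0 - 1 = 0 := by omega
  have e2 : 0 + 1 + n + 0 - 1 = n := by omega
  rw [dblP_dblElt, dblCoeff_self, choose_neg_sub, hd, if_pos (by omega), if_pos (by omega), e1, e2,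
    Ring.choose_zero_right]
  simp [Nat.choose]
  rw [sub_eq_add_neg]

theorem dblP_one_bottom' (u v : A) :
    dblP F A 2 (dblElt 1 u 0 1) (dblElt 1 v 1 0) = (-2 : ℤ) • dblElt 1 (u * v) 0 0 := by
  have hd : kd0 1 = 0 := rfl
  rw [dblP_dblElt, dblCoeff_self, choose_neg_sub, hd, if_pos (by omega), if_neg (by omega)]
  simp [Nat.choose]
end

/-! ### Generators of the matrix conformal algebras -/

section Matrix
variable {F : Type*} [Field F] {k : ℕ}

theorem dblElt_mem_of_single_mem (W : Submodule F (RMat F k)) (i : Fin 2) (m n : ℕ)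
    (h : ∀ a b, dblElt i (Matrix.single a b (1 : F)) m n ∈ W) (u : Matrix (Fin k) (Fin k) F) :
    dblElt i u m n ∈ W := by
  have hu : u ∈ W.comap (Finsupp.lsingle (R := F) (i, m, n)) := by
    rw [Matrix.matrix_eq_sum_single u]
    refine sum_mem fun a _ => sum_mem fun b _ => ?_
    have : Matrix.single a b (u a b) = u a b • Matrix.single a b (1 : F) := by
      rw [Matrix.smul_single, smul_eq_mul, mul_one]
    rw [this]
    exact Submodule.smul_mem _ _ (h a b)
  exact hu

/-- The relations `h1` alone link the diagonal at `(m+1, n)` to that at `(m, n+1)` without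
determining either. The relations `h2`, which preserve degree, settle the diagonal at `m = 0`, where
the chain begins. -/
theorem dblElt_matrix_mem_of_relations [CharZero F] (hk : 1 < k) (W : Submodule F (RMat F k))
    (i : Fin 2) (r : ℕ) (h0 : ∀ u, dblElt i u 0 r ∈ W)
    (h1 : ∀ m n, r ≤ n → ∃ α β : ℤ, α ≠ 0 ∧ β ≠ 0 ∧ ∀ u v, dblElt i v m n ∈ W →
      α • dblElt i (u * v) (m + 1) n + β • dblElt i (v * u) m (n + 1) ∈ W)
    (h2 : ∀ n, r < n → ∃ γ δ : ℤ, γ + δ ≠ 0 ∧ ∀ u v, dblElt i v 0 n ∈ W →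
      γ • dblElt i (u * v) 0 n + δ • dblElt i (v * u) 0 n ∈ W)
    (u : Matrix (Fin k) (Fin k) F) (m n : ℕ) (hn : r ≤ n) : dblElt i u m n ∈ W := by
  have key : ∀ m n, r ≤ n → (∀ u, dblElt i u m n ∈ W) →
      ((∀ a c, a ≠ c → dblElt i (Matrix.single a c (1 : F)) (m + 1) n ∈ W) ∧
       (∀ a c, a ≠ c → dblElt i (Matrix.single a c (1 : F)) m (n + 1) ∈ W) ∧
       (∀ a b, dblElt i (Matrix.single a a (1 : F)) m (n + 1) -
          dblElt i (Matrix.single b b (1 : F)) m (n + 1) ∈ W) ∧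
       (∀ a, dblElt i (Matrix.single a a (1 : F)) m (n + 1) ∈ W →
          dblElt i (Matrix.single a a (1 : F)) (m + 1) n ∈ W)) := by
    intro m n hn hmem
    obtain ⟨α, β, hα, hβ, hrel⟩ := h1 m n hn
    have diag : ∀ a b, α • dblElt i (Matrix.single a a (1 : F)) (m + 1) n +
        β • dblElt i (Matrix.single b b (1 : F)) m (n + 1) ∈ W := by
      intro a b
      have := hrel (Matrix.single a b 1) (Matrix.single b a 1) (hmem _)
      rwa [Matrix.single_mul_single_same, Matrix.single_mul_single_same, mul_one] at this
    refine ⟨fun a c hac => ?_, fun a c hac => ?_, fun a b => ?_, fun a ha => ?_⟩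
    · have := hrel (Matrix.single a a 1) (Matrix.single a c 1) (hmem _)
      rw [Matrix.single_mul_single_same, Matrix.single_mul_single_of_ne _ _ _ _ hac.symm, mul_one,
        dblElt_zero, smul_zero, add_zero] at this
      exact mem_of_zsmul_mem W hα this
    · have := hrel (Matrix.single a c 1) (Matrix.single a a 1) (hmem _)
      rw [Matrix.single_mul_single_same, Matrix.single_mul_single_of_ne _ _ _ _ hac.symm, mul_one,
        dblElt_zero, smul_zero, zero_add] at this
      exact mem_of_zsmul_mem W hβ this
    · refine mem_of_zsmul_mem W hβ ?_
      convert sub_mem (diag a a) (diag a b) using 1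
      module
    · refine mem_of_zsmul_mem W hα ?_
      convert sub_mem (diag a a) (zsmul_mem ha β) using 1
      module
  -- Outer induction on the degree above the minimum; within one degree, induction on `m`, as the
  -- diagonal at `(m+1, n)` comes from `(m, n+1)`.
  have hD : ∀ D m n, r ≤ n → m + n = r + D → ∀ u, dblElt i u m n ∈ W := by
    intro D
    induction D with
    | zero =>
      intro m n hn hmn u
      obtain rfl : m = 0 := by omega
      obtain rfl : n = r := by omega
      exact h0 u
    | succ D ih =>
      intro m
      induction m with
      | zero =>
        intro n hn hmn
        obtain ⟨n, rfl⟩ : ∃ n', n = n' + 1 := ⟨n - 1, by omega⟩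
        obtain ⟨-, hoff, hdiff, -⟩ := key 0 n (by omega) (ih 0 n (by omega) (by omega))
        obtain ⟨γ, δ, hγδ, hrel⟩ := h2 (n + 1) (by omega)
        refine dblElt_mem_of_single_mem W i _ _ fun a c => ?_
        by_cases hac : a = c
        · subst hac
          have : Nontrivial (Fin k) := Fin.nontrivial_iff_two_le.2 hk
          obtain ⟨b, hb⟩ := exists_ne a
          -- This gives `γ E_{aa} + δ E_{bb}`; adding `δ (E_{aa} - E_{bb})` leaves `(γ + δ) E_{aa}`.
          have := hrel (Matrix.single a b 1) (Matrix.single b a 1) (hoff b a hb)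
          rw [Matrix.single_mul_single_same, Matrix.single_mul_single_same, mul_one] at this
          refine mem_of_zsmul_mem W hγδ ?_
          convert add_mem this (zsmul_mem (hdiff a b) δ) using 1
          module
        · exact hoff a c hac
      | succ m ihm =>
        intro n hn hmn
        obtain ⟨hoff, -, -, hdiag⟩ := key m n hn (ih m n hn (by omega))
        refine dblElt_mem_of_single_mem W i _ _ fun a c => ?_
        by_cases hac : a = c
        · subst hac
          exact hdiag a (ihm (n + 1) (by omega) (by omega) _)
        · exact hoff a c hac
  exact hD (m + n - r) m n hn (by omega) u

theorem isConformallyGeneratedBy_dblSpan (i : Fin 2) (r : ℕ) (T : Set (RMat F k))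
    (hT : T ⊆ dblSpan F (Matrix (Fin k) (Fin k) F) i r)
    (h : ∀ u m n, r ≤ n → dblElt i u m n ∈
      Submodule.span F {w | ConformalWord (dblP F (Matrix (Fin k) (Fin k) F)) T w}) :
    IsConformallyGeneratedBy (dblP F (Matrix (Fin k) (Fin k) F))
      (dblSpan F (Matrix (Fin k) (Fin k) F) i r) T := by
  refine le_antisymm (Submodule.span_le.2 ?_)
    (span_conformalWord_le (isConformalSubalgebra_dblSpan i r) hT)
  rintro _ ⟨u, m, n, hn, rfl⟩
  exact h u m n hn

theorem dblElt_mem_of_one_mem (W : Submodule F (RMat F 1)) (i : Fin 2) (m n : ℕ)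
    (h : dblElt i 1 m n ∈ W) (u : Matrix (Fin 1) (Fin 1) F) : dblElt i u m n ∈ W := by
  have : u = u 0 0 • (1 : Matrix (Fin 1) (Fin 1) F) := by
    ext a b
    obtain rfl := Subsingleton.elim a 0
    obtain rfl := Subsingleton.elim b 0
    simp
  rw [this, dblElt_smul]
  exact W.smul_mem _ h

theorem matConf_add_two_generated [CharZero F] (hk : 1 < k) (ℓ : ℕ) :
    IsConformallyGeneratedBy (dblP F (Matrix (Fin k) (Fin k) F)) (matConf F k (ℓ + 2))
      (matConfWeight F k (ℓ + 2) (ℓ + 2) : Set (RMat F k)) := by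
  have hT : ∀ u, dblElt 0 u 0 ℓ ∈ (matConfWeight F k (ℓ + 2) (ℓ + 2) : Set (RMat F k)) :=
    fun u => Submodule.subset_span ⟨u, 0, ℓ, le_rfl, by omega, rfl⟩
  rw [matConf_add_two]
  refine isConformallyGeneratedBy_dblSpan 0 ℓ _ ?_
    (dblElt_matrix_mem_of_relations hk _ 0 ℓ (fun u => mem_span_conformalWord (hT u)) ?_ ?_)
  · refine Submodule.span_le.2 ?_
    rintro _ ⟨u, m, n, hn, -, rfl⟩
    exact dblElt_mem_dblSpan 0 u m hn
  · intro m n hn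
    refine ⟨_, _, ?_, ?_, fun u v hv => dblP_zero_raise (F := F) u v ℓ m n ▸
      product_mem_span_conformalWord ℓ (hT u) hv⟩
    · have : 0 < (m + 1 + ℓ).choose ℓ := Nat.choose_pos (by omega)
      exact mul_ne_zero (by positivity) (mul_ne_zero (pow_ne_zero _ (by norm_num)) (by positivity))
    · have : 0 < (n + 1).choose ℓ := Nat.choose_pos (by omega)
      positivity
  · intro n hn
    refine ⟨_, _, ?_, fun u v hv => dblP_zero_keep (F := F) u v ℓ n ▸
      product_mem_span_conformalWord (ℓ + 1) (hT u) hv⟩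
    -- The sum `γ + δ` is `(-1)^ℓ (ℓ+1) + (n+1) binom(n, ℓ)`, whose second term dominates for `n >
    -- ℓ`. At `n = ℓ` with `ℓ` odd it would vanish.
    have h1 : 1 ≤ (n.choose ℓ : ℤ) := by exact_mod_cast Nat.choose_pos (by omega : ℓ ≤ n)
    have h2 : (ℓ : ℤ) < n := by exact_mod_cast hn
    have h3 : (ℓ : ℤ) + 1 < ((n : ℤ) + 1) * (n.choose ℓ : ℤ) := by nlinarith
    have h4 : (0 : ℤ) ≤ ℓ := by positivity
    rcases neg_one_pow_eq_or ℤ ℓ with h | h <;> rw [h] <;> intro h0 <;> linarith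

theorem matConf_add_two_generated_one [CharZero F] (ℓ : ℕ) :
    IsConformallyGeneratedBy (dblP F (Matrix (Fin 1) (Fin 1) F)) (matConf F 1 (ℓ + 2))
      {dblElt 0 1 0 ℓ, dblElt 0 1 0 (ℓ + 1)} := by
  rw [matConf_add_two]
  refine isConformallyGeneratedBy_dblSpan 0 ℓ _ ?_ fun u m n hn =>
    dblElt_mem_of_one_mem _ _ _ _ (dblElt_one_mem_of_two_relations _ 0 ℓ
      (mem_span_conformalWord (by simp)) ?_ m n hn) u
  · rintro _ (rfl | rfl)
    · exact dblElt_mem_dblSpan 0 _ _ le_rfl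
    · exact dblElt_mem_dblSpan 0 _ _ (by omega)
  · intro m n hn hmem
    have e1 := product_mem_span_conformalWord (P := dblP F (Matrix (Fin 1) (Fin 1) F))
      (T := {dblElt 0 1 0 ℓ, dblElt 0 1 0 (ℓ + 1)}) (u := dblElt 0 1 0 ℓ) ℓ (by simp) hmem
    have e2 := product_mem_span_conformalWord (P := dblP F (Matrix (Fin 1) (Fin 1) F))
      (T := {dblElt 0 1 0 ℓ, dblElt 0 1 0 (ℓ + 1)}) (u := dblElt 0 1 0 (ℓ + 1)) (ℓ + 1)
      (by simp) hmem
    rw [dblP_zero_raise, mul_one] at e1 e2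
    refine ⟨_, _, _, _, ?_, e1, e2⟩
    have p1 : 0 < (m + 1 + ℓ).choose ℓ := Nat.choose_pos (by omega)
    have p2 : 0 < (m + 1 + (ℓ + 1)).choose (ℓ + 1) := Nat.choose_pos (by omega)
    have p3 : 0 < (n + 1).choose ℓ := Nat.choose_pos (by omega)
    have p4 : 0 < (n + 1).choose (ℓ + 1) := Nat.choose_pos (by omega)
    -- Up to the sign `(-1)^ℓ` this is the determinant: the orders `ℓ` and `ℓ + 1` have opposite
    -- parity, so its two terms add up instead of cancelling.
    have : (0 : ℤ) < ((m : ℤ) + 1) * ((n : ℤ) + 1) *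
        (((m + 1 + ℓ).choose ℓ : ℤ) * ((n + 1).choose (ℓ + 1) : ℤ) +
          ((m + 1 + (ℓ + 1)).choose (ℓ + 1) : ℤ) * ((n + 1).choose ℓ : ℤ)) := by positivity
    intro h0
    have h' := mul_ne_zero (pow_ne_zero ℓ (by norm_num : (-1 : ℤ) ≠ 0)) this.ne'
    apply h'
    rw [← h0, pow_succ]
    ring

theorem matConf_one_generated [CharZero F] (hk : 1 < k) :
    IsConformallyGeneratedBy (dblP F (Matrix (Fin k) (Fin k) F)) (matConf F k 1)
      (matConfWeight F k 1 2 : Set (RMat F k)) := by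
  have hT : ∀ u, dblElt 1 u 0 1 ∈ (matConfWeight F k 1 2 : Set (RMat F k)) :=
    fun u => Submodule.subset_span ⟨u, 0, 1, by omega, rfl⟩
  have hT' : ∀ u, dblElt 1 u 1 0 ∈ (matConfWeight F k 1 2 : Set (RMat F k)) :=
    fun u => Submodule.subset_span ⟨u, 1, 0, by omega, rfl⟩
  rw [matConf_one]
  refine isConformallyGeneratedBy_dblSpan 1 0 _ ?_
    (dblElt_matrix_mem_of_relations hk _ 1 0 (fun u => ?_) ?_ ?_)
  · refine Submodule.span_le.2 ?_
    rintro _ ⟨u, m, n, -, rfl⟩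
    exact dblElt_mem_dblSpan 1 u m (Nat.zero_le n)
  -- The weight-one elements are not generators; they are recovered from weight two by a product
  -- that lowers the weight.
  · have := product_mem_span_conformalWord (P := dblP F (Matrix (Fin k) (Fin k) F)) 2 (hT u)
      (mem_span_conformalWord (hT' 1))
    rw [dblP_one_bottom', mul_one] at this
    exact mem_of_zsmul_mem _ (by norm_num) this
  · intro m n hn
    exact ⟨_, _, by positivity, by positivity, fun u v hv => dblP_one_raise (F := F) u v m n ▸
      product_mem_span_conformalWord 0 (hT' u) hv⟩
  · intro n hn
    exact ⟨_, _, by omega, fun u v hv => dblP_one_keep (F := F) u v n ▸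
      product_mem_span_conformalWord 1 (hT u) hv⟩

theorem matConf_one_generated_one [CharZero F] :
    IsConformallyGeneratedBy (dblP F (Matrix (Fin 1) (Fin 1) F)) (matConf F 1 1)
      {dblElt 1 1 1 0, dblElt 1 1 0 2} := by
  rw [matConf_one]
  have m1 : dblElt 1 1 1 0 ∈ ({dblElt 1 1 1 0, dblElt 1 1 0 2} : Set (RMat F 1)) := by simp
  have m2 : dblElt 1 1 0 2 ∈ ({dblElt 1 1 1 0, dblElt 1 1 0 2} : Set (RMat F 1)) := by simp
  refine isConformallyGeneratedBy_dblSpan 1 0 _ ?_ fun u m n hn =>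
    dblElt_mem_of_one_mem _ _ _ _ (dblElt_one_mem_of_two_relations _ 1 0 ?_ ?_ m n hn) u
  · rintro _ (rfl | rfl) <;> exact dblElt_mem_dblSpan 1 _ _ (Nat.zero_le _)
  · have := product_mem_span_conformalWord (P := dblP F (Matrix (Fin 1) (Fin 1) F)) 3 m2
      (mem_span_conformalWord m1)
    rw [dblP_one_bottom, mul_one] at this
    exact mem_of_zsmul_mem _ (by norm_num) this
  · intro m n hn hmem
    have e1 := product_mem_span_conformalWord 0 m1 hmem
    have e2 := product_mem_span_conformalWord 1 m2 hmem
    rw [dblP_one_raise, mul_one] at e1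
    rw [dblP_one_raise', mul_one] at e2
    refine ⟨_, _, _, _, ?_, e1, e2⟩
    have p1 : 0 < (m + 2).choose 2 := Nat.choose_pos (by omega)
    -- This is minus the determinant of the two relations.
    have : (0 : ℤ) < ((m : ℤ) + 1) * ((n + 1).choose 2 : ℤ) +
      ((m + 2).choose 2 : ℤ) * ((n : ℤ) + 1) := by positivity
    intro h0
    linarith
end Matrix

theorem theorem3p1 (F : Type*) [Field F] [CharZero F] (k : ℕ) (hk : 1 ≤ k) :
    -- `R(M_{k × k}(F))` is a conformal algebra with subalgebras `R_{k×k,ℓ}`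
    IsConformalAlgebra F (dblD F (Matrix (Fin k) (Fin k) F)) (dblP F (Matrix (Fin k) (Fin k) F)) ∧
    (∀ ℓ : ℕ, 1 ≤ ℓ → IsConformalSubalgebra (dblD F (Matrix (Fin k) (Fin k) F))
      (dblP F (Matrix (Fin k) (Fin k) F)) (matConf F k ℓ)) ∧
    -- simplicity
    (∀ ℓ : ℕ, 1 ≤ ℓ → IsSimpleConformal (dblD F (Matrix (Fin k) (Fin k) F))
      (dblP F (Matrix (Fin k) (Fin k) F)) (matConf F k ℓ)) ∧
    -- generators, second index at least two
    (1 < k → ∀ ℓ : ℕ, 2 ≤ ℓ → IsConformallyGeneratedBy (dblP F (Matrix (Fin k) (Fin k) F))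
      (matConf F k ℓ) (matConfWeight F k ℓ ℓ : Set (RMat F k))) ∧
    (k = 1 → ∀ ℓ : ℕ, IsConformallyGeneratedBy (dblP F (Matrix (Fin k) (Fin k) F))
      (matConf F k (ℓ + 2)) {dblElt 0 1 0 ℓ, dblElt 0 1 0 (ℓ + 1)}) ∧
    -- generators, second index one
    (1 < k → IsConformallyGeneratedBy (dblP F (Matrix (Fin k) (Fin k) F))
      (matConf F k 1) (matConfWeight F k 1 2 : Set (RMat F k))) ∧
    (k = 1 → IsConformallyGeneratedBy (dblP F (Matrix (Fin k) (Fin k) F))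
      (matConf F k 1) {dblElt 1 1 1 0, dblElt 1 1 0 2}) := by
  refine ⟨isConformalAlgebra_dbl, fun ℓ hℓ => ?_, fun ℓ hℓ => ?_, fun hk1 ℓ hℓ => ?_,
    fun hk1 ℓ => ?_, fun hk1 => matConf_one_generated hk1, fun hk1 => ?_⟩
  · obtain ⟨i, r, h⟩ := exists_matConf_eq F k ℓ hℓ
    rw [h]
    exact isConformalSubalgebra_dblSpan i r
  · obtain ⟨i, r, h⟩ := exists_matConf_eq F k ℓ hℓ
    rw [h]
    exact isSimpleConformal_dblSpan i r (matrix_span_mul_mul_eq_top F k)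
  · obtain ⟨ℓ, rfl⟩ : ∃ ℓ', ℓ = ℓ' + 2 := ⟨ℓ - 2, by omega⟩
    exact matConf_add_two_generated hk1 ℓ
  · subst hk1
    exact matConf_add_two_generated_one ℓ
  · subst hk1
    exact matConf_one_generated_one
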